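/- A birth-and-death chain is a discrete-time Markov chain $(X_t)$ on a state space $\Omega=\{0,\dots,n\}$, $n\ge 0$, with transition kernel $P$ satisfying $P(x,y)=0$ whenever $|x-y|>1$; it is lazy if $P(x,x)\ge \frac12$ for all $x\in\Omega$. For an irreducible such chain with stationary distribution $\pi$ let $$d(t)=\max_{x\in\Omega}\|P^t(x,\cdot)-\pi\|_{\mathrm{TV}},\qquad \|\mu-\nu\|_{\mathrm{TV}}=\tfrac12\sum_{x\in\Omega}|\mu(x)-\nu(x)|,\qquad t_{\mathrm{mix}}(\epsilon)=\min\{t\in\mathbb{N}: d(t)\le\epsilon\},$$ and let $t_{\mathrm{rel}}=(1-\lambda)^{-1}$, where $\lambda$ is the largest absolute value of the eigenvalues of $P$ different from $1$ ($\lambda=0$ if there are none). Theorem. For every $0<\epsilon<\frac12$ there is an explicit constant $c_\epsilon>0$, depending only on $\epsilon$, such that every lazy irreducible birth-and-death chain satisfies $$t_{\mathrm{mix}}(\epsilon)-t_{\mathrm{mix}}(1-\epsilon)\le c_\epsilon\sqrt{t_{\mathrm{rel}}\cdot t_{\mathrm{mix}}(\tfrac14)}\,.$$ One may take $$c_\epsilon=\max\Big\{24\max\{1/\epsilon,\,64\},\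 \max\{\epsilon^{-5/2}\log_2(1/\epsilon),\,64\}\Big\}.$$ -/

import Mathlib

namespace BirthDeath

open scoped Matrix

/-- `π` is a stationary distribution of the transition kernel `P`: a probability vector with
`π P = π`. (For an irreducible kernel there is exactly one.) -/
def IsStationaryDistribution {Ω : Type*} [Fintype Ω] (P : Matrix Ω Ω ℝ) (π : Ω → ℝ) : Prop :=
  π ∈ stdSimplex ℝ Ω ∧ π ᵥ* P = π

/-- Total-variation distance of two distributions on a finite set,
`‖μ - ν‖ = (1/2) ∑ₓ |μ(x) - ν(x)|`. -/
noncomputable def tvDist {Ω : Type*} [Fintype Ω] (μ ν : Ω → ℝ) : ℝ :=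
  (1 / 2) * ∑ x, |μ x - ν x|

/-- Worst-case total-variation distance to stationarity at time `t`: the law of the chain at time
`t` started at `x` is the row `P ^ t (x, ·)`. -/
noncomputable def worstDist {Ω : Type*} [Fintype Ω] [DecidableEq Ω]
    (P : Matrix Ω Ω ℝ) (π : Ω → ℝ) (t : ℕ) : ℝ :=
  ⨆ x : Ω, tvDist ((P ^ t) x) π

/-- Total-variation mixing time: the least `t` with `d(t) ≤ ε`. (For a lazy irreducible chain such
`t` exist for every `ε > 0`, so that the infimum is a minimum.) -/
noncomputable def tMix {Ω : Type*} [Fintype Ω] [DecidableEq Ω]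
    (P : Matrix Ω Ω ℝ) (π : Ω → ℝ) (ε : ℝ) : ℕ :=
  sInf {t : ℕ | worstDist P π t ≤ ε}

/-- Largest absolute value of the nontrivial eigenvalues, that is, of those different from `1`,
of the operator `f ↦ P f`. (Irreducible birth-and-death chains are reversible, so all their
eigenvalues are real, and the eigenvalue `1` is simple. For a one-point state space there are no
nontrivial eigenvalues and the value is `0`.) -/
noncomputable def maxNontrivialEigenvalue {Ω : Type*} [Fintype Ω] [DecidableEq Ω]
    (P : Matrix Ω Ω ℝ) : ℝ :=
  sSup {r : ℝ | ∃ μ : ℝ, Module.End.HasEigenvalue (Matrix.toLin' P) μ ∧ μ ≠ 1 ∧ r = |μ|}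

/-- Spectral gap (absolute version). -/
noncomputable def gap {Ω : Type*} [Fintype Ω] [DecidableEq Ω] (P : Matrix Ω Ω ℝ) : ℝ :=
  1 - maxNontrivialEigenvalue P

/-- Relaxation time, the inverse of the spectral gap. -/
noncomputable def tRel {Ω : Type*} [Fintype Ω] [DecidableEq Ω] (P : Matrix Ω Ω ℝ) : ℝ :=
  (gap P)⁻¹

/-- `P` is the transition kernel of a birth-and-death chain on `{0, …, n}`: a Markov chain which at
every step moves to an adjacent state or stays in place. -/
structure IsBirthDeathChain {n : ℕ} (P : Matrix (Fin (n + 1)) (Fin (n + 1)) ℝ) : Prop where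
  stochastic : P ∈ Matrix.rowStochastic ℝ (Fin (n + 1))
  adjacent : ∀ i j : Fin (n + 1), (i : ℕ) + 1 < j ∨ (j : ℕ) + 1 < i → P i j = 0

/-- A chain is lazy if it stays in place with probability at least `1/2` at every state. -/
def IsLazy {Ω : Type*} (P : Matrix Ω Ω ℝ) : Prop :=
  ∀ x, 1 / 2 ≤ P x x

/-- The explicit constant
`c_ε = max {24 · max {1/ε, 64}, max {log₂(1/ε) / ε^(5/2), 64}}`. -/
noncomputable def windowConst (ε : ℝ) : ℝ :=
  max (24 * max (1 / ε) 64) (max (Real.logb 2 (1 / ε) / ε ^ (5 / 2 : ℝ)) 64)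

end BirthDeath

/-! A chain started at the left end mixes when it has crossed the bulk of `π`, and the crossing time
is concentrated. Let `a` and `b` be the `ε/4` and `1 - ε/4` quantiles. Before `a` is reached the
chain is far from `π` (`tvDist_zero_ge`); well after `b` is reached it is close on all initial
segments (`pow_below_sub_cdf_le`). So the window is bounded by the standard deviations of the two
hitting times plus the difference of their means.

All of these are controlled by a Poincaré inequality with constant `tRel P`, tested on the potential
of a unit flow between two states. It bounds effective resistances (`cdf_mul_resist_le`,
`mul_resist_le`), hence the variance by a multiple of relaxation time times mean (`hitVar_le`), and
the difference of the means by `O(tRel/ε)`. The mean to `a` is at most `2 tMix(1/4)`, and `tRel ≤ 2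
tMix(1/4)`, so every contribution is `O(√(tRel · tMix(1/4)) / ε^(3/2))` (`exists_window`).

Initial segments and the two ends suffice because a lazy kernel is totally positive of order two:
laws from different starting points have monotone likelihood ratio (`worstDist_le_of_ends`). The
right end is the left end of the reflected chain.

Hitting times never appear as random variables. Their mean and variance are explicit edge sums, and
Chebyshev's inequality is an induction over time with the supermartingale `(s + hitMean) ^ 2 +
hitVar`. -/

namespace BirthDeath

/-! ### Reversible chains as electrical networks: distribution function, conductances, generator. -/

open scoped Matrix

/-- A lazy birth-and-death chain together with a positive reversible distribution. -/
structure IsLazyReversible {n : ℕ} (P : Matrix (Fin (n + 1)) (Fin (n + 1)) ℝ)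
    (π : Fin (n + 1) → ℝ) : Prop where
  nonneg : ∀ i j, 0 ≤ P i j
  sum_row : ∀ i, ∑ j, P i j = 1
  adjacent : ∀ i j : Fin (n + 1), (i : ℕ) + 1 < j ∨ (j : ℕ) + 1 < i → P i j = 0
  lazy : ∀ i, 1 / 2 ≤ P i i
  balance : ∀ i j, π i * P i j = π j * P j i
  pos : ∀ i, 0 < π i
  sum_one : ∑ i, π i = 1
  up_pos : ∀ i j : Fin (n + 1), (i : ℕ) + 1 = j → 0 < P i j

/-- The mass function of `π`, extended by zero to `ℕ`. -/
noncomputable def mass {n : ℕ} (π : Fin (n + 1) → ℝ) (j : ℕ) : ℝ :=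
  if h : j < n + 1 then π ⟨j, h⟩ else 0

/-- The mass of the states strictly below `k`. -/
noncomputable def cdf {n : ℕ} (π : Fin (n + 1) → ℝ) (k : ℕ) : ℝ :=
  ∑ j ∈ Finset.range k, mass π j

/-- The conductance of the edge between `j - 1` and `j`. -/
noncomputable def cond {n : ℕ} (P : Matrix (Fin (n + 1)) (Fin (n + 1)) ℝ)
    (π : Fin (n + 1) → ℝ) (j : ℕ) : ℝ :=
  if h : 0 < j ∧ j < n + 1 then π ⟨j - 1, by omega⟩ * P ⟨j - 1, by omega⟩ ⟨j, h.2⟩ else 0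

/-- The indicator function of the states strictly below `k`. -/
noncomputable def below (n k : ℕ) : Fin (n + 1) → ℝ := fun x => if (x : ℕ) < k then 1 else 0

section Basic

variable {n : ℕ} {P : Matrix (Fin (n + 1)) (Fin (n + 1)) ℝ} {π : Fin (n + 1) → ℝ}

lemma mass_coe (x : Fin (n + 1)) : mass π x = π x := by
  rw [mass, dif_pos x.2]

lemma cdf_zero : cdf π 0 = 0 := by simp [cdf]

lemma cdf_succ (k : ℕ) : cdf π (k + 1) = cdf π k + mass π k := by
  simp [cdf, Finset.sum_range_succ]

lemma cdf_eq_sum {k : ℕ} (hk : k ≤ n + 1) : cdf π k = ∑ x, π x * below n k x := by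
  have h : ∀ x : Fin (n + 1), π x * below n k x =
      (fun j : ℕ => if j < k then mass π j else 0) x := by
    intro x
    simp [below, mass_coe]
  rw [Finset.sum_congr rfl fun x _ => h x,
    Fin.sum_univ_eq_sum_range (fun j : ℕ => if j < k then mass π j else 0), ← Finset.sum_filter,
    cdf]
  congr 1
  ext j
  simp
  omega

/-- The conductance also vanishes at `n + 1`, so the two ends need no separate treatment in the
divergence form of the generator. -/
lemma cond_zero : cond P π 0 = 0 := by simp [cond]

lemma cond_eq {x y : Fin (n + 1)} (h : (x : ℕ) + 1 = y) : cond P π y = π x * P x y := by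
  have h1 : 0 < (y : ℕ) ∧ (y : ℕ) < n + 1 := ⟨by omega, y.2⟩
  have h2 : (⟨(y : ℕ) - 1, by omega⟩ : Fin (n + 1)) = x := Fin.ext (by simp; omega)
  rw [cond, dif_pos h1, h2]

namespace IsLazyReversible

variable (C : IsLazyReversible P π)
include C

lemma mass_nonneg (j : ℕ) : 0 ≤ mass π j := by
  unfold mass
  split_ifs with h
  · exact (C.pos _).le
  · exact le_rfl

lemma mass_pos {j : ℕ} (hj : j ≤ n) : 0 < mass π j := by
  rw [mass, dif_pos (by omega)]
  exact C.pos _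

lemma cdf_mono : Monotone (cdf π) := by
  refine monotone_nat_of_le_succ fun k => ?_
  rw [cdf_succ]
  linarith [C.mass_nonneg k]

lemma cdf_nonneg (k : ℕ) : 0 ≤ cdf π k := Finset.sum_nonneg fun j _ => C.mass_nonneg j

lemma cdf_top : cdf π (n + 1) = 1 := by
  rw [cdf_eq_sum le_rfl, ← C.sum_one]
  refine Finset.sum_congr rfl fun x _ => ?_
  have := x.2
  simp [below, this]

lemma cdf_le_one {k : ℕ} (hk : k ≤ n + 1) : cdf π k ≤ 1 := by
  rw [← C.cdf_top]
  exact C.cdf_mono hk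

lemma cdf_succ_pos {k : ℕ} (hk : k ≤ n) : 0 < cdf π (k + 1) := by
  rw [cdf_succ]
  linarith [C.cdf_nonneg k, C.mass_pos hk]

lemma cond_nonneg (j : ℕ) : 0 ≤ cond P π j := by
  unfold cond
  split_ifs with h
  · exact mul_nonneg (C.pos _).le (C.nonneg _ _)
  · exact le_rfl

lemma cond_pos {j : ℕ} (h : j < n) : 0 < cond P π (j + 1) := by
  rw [cond, dif_pos ⟨by omega, by omega⟩]
  exact mul_pos (C.pos _) (C.up_pos _ _ (by simp))

/-- The action of the kernel on a function vanishing at the starting point. -/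
lemma mul_sum_of_eq_zero (φ : ℕ → ℝ) (x : Fin (n + 1)) (hx : φ x = 0) :
    π x * ∑ y : Fin (n + 1), P x y * φ y =
      cond P π (x + 1) * φ (x + 1) + cond P π x * φ (x - 1) := by
  have hsplit : ∀ y : Fin (n + 1), P x y * φ y =
      (if (y : ℕ) = x + 1 then P x y * φ y else 0) +
        (if (y : ℕ) + 1 = x then P x y * φ y else 0) := by
    intro y
    by_cases h1 : (y : ℕ) = x + 1
    · rw [if_pos h1, if_neg (by omega), add_zero]
    · by_cases h2 : (y : ℕ) + 1 = x
      · rw [if_neg h1, if_pos h2, zero_add]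
      · rw [if_neg h1, if_neg h2]
        by_cases h3 : (y : ℕ) = x
        · rw [h3, hx]; ring
        · rw [C.adjacent x y (by omega)]; ring
  rw [Finset.sum_congr rfl fun y _ => hsplit y, Finset.sum_add_distrib, mul_add]
  congr 1
  · by_cases h : (x : ℕ) + 1 < n + 1
    · rw [Finset.sum_eq_single ⟨(x : ℕ) + 1, h⟩, if_pos rfl]
      · have := cond_eq (P := P) (π := π) (x := x) (y := ⟨(x : ℕ) + 1, h⟩) rfl
        simp only at this
        rw [this]; ring
      · intro y _ hy
        rw [if_neg]
        intro h'
        exact hy (Fin.ext h')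
      · simp
    · rw [Finset.sum_eq_zero, cond, dif_neg (by omega)]
      · ring
      · intro y _
        rw [if_neg (by have := y.2; omega)]
  · rcases Nat.eq_zero_or_pos (x : ℕ) with h | h
    · rw [Finset.sum_eq_zero, h, cond_zero]
      · ring
      · intro y _
        rw [if_neg (by omega)]
    · have h' : (x : ℕ) - 1 < n + 1 := by have := x.2; omega
      rw [Finset.sum_eq_single ⟨(x : ℕ) - 1, h'⟩, if_pos (by simp; omega)]
      · have := cond_eq (P := P) (π := π) (x := ⟨(x : ℕ) - 1, h'⟩) (y := x) (by simp; omega)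
        rw [this, C.balance]
        ring
      · intro y _ hy
        rw [if_neg]
        intro h''
        exact hy (Fin.ext (by simp; omega))
      · simp

/-- The generator of the chain in divergence form. -/
lemma generator (u : ℕ → ℝ) (x : Fin (n + 1)) :
    π x * (∑ y : Fin (n + 1), P x y * u y - u x) =
      cond P π (x + 1) * (u (x + 1) - u x) - cond P π x * (u x - u (x - 1)) := by
  have h := C.mul_sum_of_eq_zero (fun j => u j - u x) x (by simp)
  have h' : ∑ y : Fin (n + 1), P x y * (u y - u x) = ∑ y : Fin (n + 1), P x y * u y - u x := by
    simp_rw [mul_sub]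
    rw [Finset.sum_sub_distrib, ← Finset.sum_mul, C.sum_row, one_mul]
  simp only [h'] at h
  rw [h]
  ring

lemma pow_nonneg (t : ℕ) (x y : Fin (n + 1)) : 0 ≤ (P ^ t) x y := by
  induction t generalizing x y with
  | zero =>
    rw [pow_zero, Matrix.one_apply]
    split_ifs <;> norm_num
  | succ t ih =>
    rw [pow_succ, Matrix.mul_apply]
    exact Finset.sum_nonneg fun z _ => mul_nonneg (ih x z) (C.nonneg z y)

lemma sum_pow_row (t : ℕ) (x : Fin (n + 1)) : ∑ y, (P ^ t) x y = 1 := by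
  induction t generalizing x with
  | zero => simp [Matrix.one_apply]
  | succ t ih =>
    simp_rw [pow_succ, Matrix.mul_apply]
    rw [Finset.sum_comm]
    simp_rw [← Finset.mul_sum, C.sum_row, mul_one]
    exact ih x

lemma stationary (y : Fin (n + 1)) : ∑ x, π x * P x y = π y := by
  simp_rw [C.balance _ y]
  rw [← Finset.mul_sum, C.sum_row, mul_one]

lemma stationary_pow (t : ℕ) (y : Fin (n + 1)) : ∑ x, π x * (P ^ t) x y = π y := by
  induction t generalizing y with
  | zero => simp [Matrix.one_apply]
  | succ t ih =>
    simp_rw [pow_succ, Matrix.mul_apply, Finset.mul_sum]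
    rw [Finset.sum_comm]
    simp_rw [← mul_assoc, ← Finset.sum_mul, ih]
    exact C.stationary y

end IsLazyReversible

end Basic

/-- Conditioning on the first step. -/
lemma pow_succ_mulVec {n : ℕ} (P : Matrix (Fin (n + 1)) (Fin (n + 1)) ℝ) (t : ℕ)
    (f : Fin (n + 1) → ℝ) (x : Fin (n + 1)) :
    (P ^ (t + 1) *ᵥ f) x = ∑ y, P x y * (P ^ t *ᵥ f) y := by
  rw [pow_succ', ← Matrix.mulVec_mulVec]
  rfl

end BirthDeath

/-! ### Total positivity, monotonicity in the starting point, and reflection. -/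

namespace BirthDeath

open scoped Matrix

lemma sum_fin_rev {n : ℕ} (f : Fin (n + 1) → ℝ) : ∑ x : Fin (n + 1), f x.rev = ∑ x, f x :=
  Equiv.sum_comp Fin.revPerm f

/-- Nonnegativity of all minors of order two. -/
def IsTP2 {n : ℕ} (M : Matrix (Fin (n + 1)) (Fin (n + 1)) ℝ) : Prop :=
  ∀ i i' j j', i ≤ i' → j ≤ j' → M i j' * M i' j ≤ M i j * M i' j'

/-- Cauchy–Binet: antisymmetrizing the double sum for a minor of the product gives twice the minor
as a sum of products of minors of equal sign. -/
lemma IsTP2.mul {n : ℕ} {M N : Matrix (Fin (n + 1)) (Fin (n + 1)) ℝ} (hM : IsTP2 M)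
    (hN : IsTP2 N) : IsTP2 (M * N) := by
  intro i i' j j' hi hj
  have key : 0 ≤ ∑ k, ∑ l, (M i k * M i' l - M i l * M i' k) *
      (N k j * N l j' - N k j' * N l j) := by
    refine Finset.sum_nonneg fun k _ => Finset.sum_nonneg fun l _ => ?_
    rcases le_total k l with h | h
    · exact mul_nonneg (sub_nonneg.2 (hM i i' k l hi h))
        (sub_nonneg.2 (by have := hN k l j j' h hj; linarith))
    · exact mul_nonneg_of_nonpos_of_nonpos (sub_nonpos.2 (hM i i' l k hi h))
        (sub_nonpos.2 (by have := hN l k j j' h hj; linarith))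
  have e1 : ∑ k, ∑ l, (M i l * M i' k) * (N k j * N l j' - N k j' * N l j) =
      -∑ k, ∑ l, (M i k * M i' l) * (N k j * N l j' - N k j' * N l j) := by
    rw [Finset.sum_comm, ← Finset.sum_neg_distrib]
    refine Finset.sum_congr rfl fun k _ => ?_
    rw [← Finset.sum_neg_distrib]
    exact Finset.sum_congr rfl fun l _ => by ring
  simp_rw [sub_mul (M i _ * M i' _)] at key
  simp_rw [Finset.sum_sub_distrib] at key
  rw [e1] at key
  have e2 : (M * N) i j * (M * N) i' j' - (M * N) i j' * (M * N) i' j =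
      ∑ k, ∑ l, (M i k * M i' l) * (N k j * N l j' - N k j' * N l j) := by
    simp_rw [Matrix.mul_apply, Finset.sum_mul_sum, ← Finset.sum_sub_distrib]
    refine Finset.sum_congr rfl fun k _ => Finset.sum_congr rfl fun l _ => by ring
  linarith

/-- The total-variation distance of two distributions with monotone likelihood ratio is attained
on an initial segment. -/
lemma exists_tvDist_eq_below {n : ℕ} {p q : Fin (n + 1) → ℝ} (hp : ∀ j, 0 ≤ p j)
    (hq : ∀ j, 0 ≤ q j) (hp1 : ∑ j, p j = 1) (hq1 : ∑ j, q j = 1)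
    (h : ∀ j j', j ≤ j' → p j' * q j ≤ p j * q j') :
    ∃ k ≤ n + 1, tvDist p q = p ⬝ᵥ below n k - q ⬝ᵥ below n k := by
  by_cases hex : ∃ j, q j < p j
  · obtain ⟨k, hk, hmax⟩ : ∃ k, q k < p k ∧ ∀ j, q j < p j → j ≤ k := by
      have hne : (Finset.univ.filter fun j => q j < p j).Nonempty := by
        obtain ⟨j, hj⟩ := hex
        exact ⟨j, by simpa using hj⟩
      refine ⟨Finset.max' _ hne, ?_, fun j hj => Finset.le_max' _ _ (by simpa using hj)⟩
      simpa using Finset.max'_mem _ hne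
    refine ⟨k + 1, by omega, ?_⟩
    have habs : ∀ j, |p j - q j| = 2 * (p j * below n (k + 1) j - q j * below n (k + 1) j) -
        (p j - q j) := by
      intro j
      by_cases hj : j ≤ k
      · have hj' : (j : ℕ) < k + 1 := by have := Fin.le_def.1 hj; omega
        have hle : q j ≤ p j := by
          have h1 := h j k hj
          by_contra! hlt
          have h2 : 0 < q j := (hp j).trans_lt hlt
          have h3 : q k * q j < p k * q j := mul_lt_mul_of_pos_right hk h2
          have h4 : p j * q k ≤ q j * q k := mul_le_mul_of_nonneg_right hlt.le (hq k)
          linarith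
        rw [abs_of_nonneg (by linarith)]
        simp [below, hj']
        ring
      · have hj' : ¬ (j : ℕ) < k + 1 := fun h' => hj (Fin.le_def.2 (by omega))
        have hle : p j ≤ q j := by
          by_contra! hlt
          exact hj (hmax j hlt)
        rw [abs_of_nonpos (by linarith)]
        simp [below, hj']
    rw [tvDist, Finset.sum_congr rfl fun j _ => habs j, Finset.sum_sub_distrib, ← Finset.mul_sum,
      Finset.sum_sub_distrib, Finset.sum_sub_distrib, hp1, hq1]
    simp only [dotProduct]
    ring
  · push Not at hex
    have heq : ∀ j, p j = q j := by
      have := (Finset.sum_eq_sum_iff_of_le (s := Finset.univ) fun j _ => hex j).1 (by rw [hp1, hq1])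
      exact fun j => this j (Finset.mem_univ j)
    refine ⟨0, by omega, ?_⟩
    simp [tvDist, heq, below, dotProduct]

namespace IsLazyReversible

variable {n : ℕ} {P : Matrix (Fin (n + 1)) (Fin (n + 1)) ℝ} {π : Fin (n + 1) → ℝ}
  (C : IsLazyReversible P π)
include C

lemma off_diag_le_half {x y : Fin (n + 1)} (h : x ≠ y) : P x y ≤ 1 / 2 := by
  have h1 := C.sum_row x
  have h2 : P x x + P x y ≤ ∑ j, P x j := by
    rw [← Finset.sum_pair h]
    exact Finset.sum_le_sum_of_subset_of_nonneg (Finset.subset_univ _) fun j _ _ => C.nonneg x j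
  linarith [C.lazy x]

/-- The only minors with a nonzero subtracted product and distinct rows and columns are those on two
adjacent states; there laziness makes the diagonal product at least `1/4` and the off-diagonal one
at most `1/4`. -/
lemma isTP2 : IsTP2 P := by
  intro i i' j j' hi hj
  rcases hi.eq_or_lt with rfl | hi
  · linarith
  rcases hj.eq_or_lt with rfl | hj
  · linarith
  have hnn : 0 ≤ P i j * P i' j' := mul_nonneg (C.nonneg _ _) (C.nonneg _ _)
  rw [Fin.lt_def] at hi hj
  by_cases h1 : (i : ℕ) + 1 < j'
  · rw [C.adjacent i j' (Or.inl h1), zero_mul]; exact hnn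
  by_cases h2 : (j : ℕ) + 1 < i'
  · rw [C.adjacent i' j (Or.inr h2), mul_zero]; exact hnn
  have e1 : j = i := Fin.ext (by omega)
  have e2 : j' = i' := Fin.ext (by omega)
  subst e1 e2
  have h3 := C.off_diag_le_half (x := j) (y := j') (by rintro rfl; omega)
  have h4 := C.off_diag_le_half (x := j') (y := j) (by rintro rfl; omega)
  have h5 : P j j' * P j' j ≤ 1 / 2 * (1 / 2) :=
    mul_le_mul h3 h4 (C.nonneg _ _) (by norm_num)
  have h6 : (1 / 2 : ℝ) * (1 / 2) ≤ P j j * P j' j' :=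
    mul_le_mul (C.lazy _) (C.lazy _) (by norm_num) (C.nonneg _ _)
  linarith

lemma isTP2_pow (t : ℕ) : IsTP2 (P ^ t) := by
  induction t with
  | zero =>
    intro i i' j j' hi hj
    rw [pow_zero]
    simp only [Matrix.one_apply]
    by_cases h1 : i = j'
    · by_cases h2 : i' = j
      · have e1 : i = i' := le_antisymm hi (h2 ▸ h1 ▸ hj)
        subst e1 h2
        simp [h1]
      · rw [if_neg h2, mul_zero]
        positivity
    · rw [if_neg h1, zero_mul]
      positivity
  | succ t ih =>
    rw [pow_succ]
    exact ih.mul C.isTP2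

/-- Adding up the minors of rows `x`, `x'` over columns `j < k ≤ j'` gives `f x (1 - f x') - f x' (1
- f x) = f x - f x'`, where `f` is the function in question. -/
lemma pow_below_antitone (t k : ℕ) : Antitone (P ^ t *ᵥ below n k) := by
  intro x x' hx
  have key : 0 ≤ ∑ j, ∑ j', ((P ^ t) x j * (P ^ t) x' j' - (P ^ t) x j' * (P ^ t) x' j) *
      (below n k j * (1 - below n k j')) := by
    refine Finset.sum_nonneg fun j _ => Finset.sum_nonneg fun j' _ => ?_
    by_cases hj : (j : ℕ) < k
    · by_cases hj' : (j' : ℕ) < k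
      · simp [below, hj']
      · have hle : j ≤ j' := Fin.le_def.2 (by omega)
        simpa [below, hj, hj'] using C.isTP2_pow t x x' j j' hx hle
    · simp [below, hj]
  have hrow : ∀ z, (P ^ t *ᵥ below n k) z = ∑ j, (P ^ t) z j * below n k j := fun z => rfl
  have hrow' : ∀ z, 1 - (P ^ t *ᵥ below n k) z = ∑ j, (P ^ t) z j * (1 - below n k j) := by
    intro z
    simp_rw [mul_sub, mul_one]
    rw [Finset.sum_sub_distrib, C.sum_pow_row, hrow]
  have e : ∑ j, ∑ j', ((P ^ t) x j * (P ^ t) x' j' - (P ^ t) x j' * (P ^ t) x' j) *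
      (below n k j * (1 - below n k j')) =
      (P ^ t *ᵥ below n k) x * (1 - (P ^ t *ᵥ below n k) x') -
        (P ^ t *ᵥ below n k) x' * (1 - (P ^ t *ᵥ below n k) x) := by
    rw [hrow' x, hrow' x', hrow x, hrow x']
    simp_rw [Finset.sum_mul_sum, ← Finset.sum_sub_distrib]
    refine Finset.sum_congr rfl fun j _ => Finset.sum_congr rfl fun j' _ => by ring
  rw [e] at key
  linarith

/-- Rows of a totally positive matrix have monotone likelihood ratio, so an initial segment attains
the distance; on it the two ends are the extreme starting points. -/
lemma tvDist_rows_le {t : ℕ} {η : ℝ} (h : ∀ k ≤ n + 1,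
    (P ^ t *ᵥ below n k) 0 - (P ^ t *ᵥ below n k) (Fin.last n) ≤ η) {x y : Fin (n + 1)}
    (hxy : x ≤ y) : tvDist ((P ^ t) x) ((P ^ t) y) ≤ η := by
  obtain ⟨k, hk, e⟩ := exists_tvDist_eq_below (C.pow_nonneg t x) (C.pow_nonneg t y)
    (C.sum_pow_row t x) (C.sum_pow_row t y) fun j j' hj => C.isTP2_pow t x y j j' hxy hj
  have h1 := C.pow_below_antitone t k (Fin.zero_le x)
  have h2 := C.pow_below_antitone t k (Fin.le_last y)
  have h3 : tvDist ((P ^ t) x) ((P ^ t) y) =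
    (P ^ t *ᵥ below n k) x - (P ^ t *ᵥ below n k) y := e
  linarith [h k hk]

/-- The extreme starting points control the distance to stationarity. -/
lemma worstDist_le {t : ℕ} {η : ℝ} (h : ∀ k ≤ n + 1,
    (P ^ t *ᵥ below n k) 0 - (P ^ t *ᵥ below n k) (Fin.last n) ≤ η) : worstDist P π t ≤ η := by
  refine ciSup_le fun x => ?_
  have hall : ∀ y, tvDist ((P ^ t) x) ((P ^ t) y) ≤ η := by
    intro y
    rcases le_total x y with hxy | hxy
    · exact C.tvDist_rows_le h hxy
    · have := C.tvDist_rows_le h hxy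
      simp only [tvDist, abs_sub_comm] at this ⊢
      exact this
  -- Stationarity writes `π` as the `π`-average of the rows, so convexity reduces the claim to pairs
  -- of rows.
  have hz : ∀ z, |(P ^ t) x z - π z| ≤ ∑ y, π y * |(P ^ t) x z - (P ^ t) y z| := by
    intro z
    have e : (P ^ t) x z - π z = ∑ y, π y * ((P ^ t) x z - (P ^ t) y z) := by
      simp_rw [mul_sub]
      rw [Finset.sum_sub_distrib, C.stationary_pow, ← Finset.sum_mul, C.sum_one, one_mul]
    rw [e]
    refine (Finset.abs_sum_le_sum_abs _ _).trans_eq (Finset.sum_congr rfl fun y _ => ?_)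
    rw [abs_mul, abs_of_pos (C.pos y)]
  calc tvDist ((P ^ t) x) π
      ≤ 1 / 2 * ∑ z, ∑ y, π y * |(P ^ t) x z - (P ^ t) y z| :=
        mul_le_mul_of_nonneg_left (Finset.sum_le_sum fun z _ => hz z) (by norm_num)
    _ = ∑ y, π y * tvDist ((P ^ t) x) ((P ^ t) y) := by
        rw [Finset.sum_comm, Finset.mul_sum]
        refine Finset.sum_congr rfl fun y _ => ?_
        rw [tvDist, ← Finset.mul_sum]
        ring
    _ ≤ ∑ y, π y * η := Finset.sum_le_sum fun y _ =>
        mul_le_mul_of_nonneg_left (hall y) (C.pos y).le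
    _ = η := by rw [← Finset.sum_mul, C.sum_one, one_mul]

/-- The chain reflected at the midpoint of the state space. -/
lemma reflect : IsLazyReversible (P.submatrix Fin.rev Fin.rev) (π ∘ Fin.rev) where
  nonneg i j := C.nonneg _ _
  sum_row i := by
    simp only [Matrix.submatrix_apply]
    exact (sum_fin_rev (P i.rev)).trans (C.sum_row _)
  adjacent i j h := C.adjacent _ _ (by
    have := i.2
    have := j.2
    rw [Fin.val_rev, Fin.val_rev]
    omega)
  lazy i := C.lazy _
  balance i j := C.balance _ _
  pos i := C.pos _
  sum_one := by
    simp only [Function.comp_apply]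
    exact (sum_fin_rev π).trans C.sum_one
  up_pos i j h := by
    have hu : 0 < P j.rev i.rev := C.up_pos _ _ (by
      have := i.2
      have := j.2
      rw [Fin.val_rev, Fin.val_rev]
      omega)
    have hb := C.balance j.rev i.rev
    have h1 : 0 < π j.rev * P j.rev i.rev := mul_pos (C.pos _) hu
    rw [hb] at h1
    exact (pos_iff_pos_of_mul_pos h1).1 (C.pos _)

end IsLazyReversible

section Reflect

variable {n : ℕ}

lemma below_rev {k : ℕ} (hk : k ≤ n + 1) (x : Fin (n + 1)) :
    below n k x.rev = 1 - below n (n + 1 - k) x := by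
  have := x.2
  simp only [below, Fin.val_rev]
  by_cases h : (x : ℕ) < n + 1 - k
  · rw [if_neg (by omega), if_pos h]; norm_num
  · rw [if_pos (by omega), if_neg h]; norm_num

lemma submatrix_rev_pow (P : Matrix (Fin (n + 1)) (Fin (n + 1)) ℝ) (t : ℕ) :
    (P.submatrix Fin.rev Fin.rev) ^ t = (P ^ t).submatrix Fin.rev Fin.rev := by
  induction t with
  | zero => exact (Matrix.submatrix_one_equiv Fin.revPerm).symm
  | succ t ih =>
    rw [pow_succ, ih, pow_succ]
    exact Matrix.submatrix_mul_equiv (P ^ t) P Fin.rev Fin.revPerm Fin.rev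

lemma tvDist_reflect (P : Matrix (Fin (n + 1)) (Fin (n + 1)) ℝ) (π : Fin (n + 1) → ℝ) (t : ℕ) :
    tvDist (((P.submatrix Fin.rev Fin.rev) ^ t) 0) (π ∘ Fin.rev) =
      tvDist ((P ^ t) (Fin.last n)) π := by
  rw [submatrix_rev_pow]
  simp only [tvDist, Matrix.submatrix_apply, Function.comp_apply, Fin.rev_zero]
  rw [← sum_fin_rev fun j => |(P ^ t) (Fin.last n) j - π j|]

variable {P : Matrix (Fin (n + 1)) (Fin (n + 1)) ℝ} {π : Fin (n + 1) → ℝ}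
  (C : IsLazyReversible P π)
include C

lemma reflect_pow_below (t : ℕ) {k : ℕ} (hk : k ≤ n + 1) :
    ((P.submatrix Fin.rev Fin.rev) ^ t *ᵥ below n k) 0 =
      1 - (P ^ t *ᵥ below n (n + 1 - k)) (Fin.last n) := by
  rw [submatrix_rev_pow]
  simp only [Matrix.mulVec, dotProduct, Matrix.submatrix_apply, Fin.rev_zero]
  have h : ∀ y : Fin (n + 1), (P ^ t) (Fin.last n) y.rev * below n k y =
      (fun z => (P ^ t) (Fin.last n) z * below n k z.rev) (Fin.revPerm y) := by
    intro y
    simp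
  rw [Finset.sum_congr rfl fun y _ => h y,
    Equiv.sum_comp Fin.revPerm (fun z => (P ^ t) (Fin.last n) z * below n k z.rev)]
  simp_rw [below_rev hk, mul_sub, mul_one]
  rw [Finset.sum_sub_distrib, C.sum_pow_row]

lemma cdf_reflect {k : ℕ} (hk : k ≤ n + 1) : cdf (π ∘ Fin.rev) k = 1 - cdf π (n + 1 - k) := by
  rw [cdf_eq_sum hk, cdf_eq_sum (by omega : n + 1 - k ≤ n + 1)]
  have h : ∀ y : Fin (n + 1), (π ∘ Fin.rev) y * below n k y =
      (fun z => π z * below n k z.rev) (Fin.revPerm y) := by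
    intro y
    simp
  rw [Finset.sum_congr rfl fun y _ => h y,
    Equiv.sum_comp Fin.revPerm (fun z => π z * below n k z.rev)]
  simp_rw [below_rev hk, mul_sub, mul_one]
  rw [Finset.sum_sub_distrib, C.sum_one]

/-- Mixing from both ends of the state space yields mixing from everywhere. -/
lemma worstDist_le_of_ends {t : ℕ} {η η' : ℝ}
    (h : ∀ k ≤ n + 1, (P ^ t *ᵥ below n k) 0 - cdf π k ≤ η)
    (h' : ∀ k ≤ n + 1, ((P.submatrix Fin.rev Fin.rev) ^ t *ᵥ below n k) 0 -
      cdf (π ∘ Fin.rev) k ≤ η') : worstDist P π t ≤ η + η' := by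
  refine C.worstDist_le fun k hk => ?_
  have h1 := h k hk
  -- Read in the original chain, this bounds `cdf π k` minus the probability from the right end;
  -- adding `h1` cancels `cdf π k`.
  have h2 := h' (n + 1 - k) (by omega)
  rw [reflect_pow_below C t (by omega), cdf_reflect C (by omega)] at h2
  have e : n + 1 - (n + 1 - k) = k := by omega
  rw [e] at h2
  linarith

end Reflect

end BirthDeath

/-! ### Mean and variance of hitting times, Chebyshev bounds, and convergence. -/

namespace BirthDeath

open scoped Matrix

variable {n : ℕ}

/-- Effective resistance between `x` and `m` (zero for `m ≤ x`). -/
noncomputable def resist (P : Matrix (Fin (n + 1)) (Fin (n + 1)) ℝ) (π : Fin (n + 1) → ℝ)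
    (m x : ℕ) : ℝ :=
  ∑ i ∈ Finset.Ico x m, 1 / cond P π (i + 1)

/-- Expected time to reach `m` from `x` (zero for `m ≤ x`). -/
noncomputable def hitMean (P : Matrix (Fin (n + 1)) (Fin (n + 1)) ℝ) (π : Fin (n + 1) → ℝ)
    (m x : ℕ) : ℝ :=
  ∑ i ∈ Finset.Ico x m, cdf π (i + 1) / cond P π (i + 1)

/-- Energy of `hitMean` at the states below `i`. -/
noncomputable def hitEnergy (P : Matrix (Fin (n + 1)) (Fin (n + 1)) ℝ) (π : Fin (n + 1) → ℝ)
    (i : ℕ) : ℝ :=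
  ∑ j ∈ Finset.range i,
    (cdf π (j + 1) ^ 2 / cond P π (j + 1) + cdf π j ^ 2 / cond P π j)

/-- An upper bound for the variance of the time to reach `m` from `x`. -/
noncomputable def hitVar (P : Matrix (Fin (n + 1)) (Fin (n + 1)) ℝ) (π : Fin (n + 1) → ℝ)
    (m x : ℕ) : ℝ :=
  ∑ i ∈ Finset.Ico x m, hitEnergy P π (i + 1) / cond P π (i + 1)

lemma sum_Ico_of_lt {f : ℕ → ℝ} {m x : ℕ} (h : x < m) :
    ∑ i ∈ Finset.Ico x m, f i = f x + ∑ i ∈ Finset.Ico (x + 1) m, f i :=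
  Finset.sum_eq_sum_Ico_succ_bot h f

variable {P : Matrix (Fin (n + 1)) (Fin (n + 1)) ℝ} {π : Fin (n + 1) → ℝ}

lemma hitMean_of_le {m x : ℕ} (h : m ≤ x) : hitMean P π m x = 0 := by
  simp [hitMean, Finset.Ico_eq_empty_of_le h]

lemma hitMean_of_lt {m x : ℕ} (h : x < m) :
    hitMean P π m x = cdf π (x + 1) / cond P π (x + 1) + hitMean P π m (x + 1) :=
  sum_Ico_of_lt h

lemma hitVar_of_lt {m x : ℕ} (h : x < m) :
    hitVar P π m x = hitEnergy P π (x + 1) / cond P π (x + 1) + hitVar P π m (x + 1) :=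
  sum_Ico_of_lt h

lemma resist_of_lt {m x : ℕ} (h : x < m) :
    resist P π m x = 1 / cond P π (x + 1) + resist P π m (x + 1) :=
  sum_Ico_of_lt h

namespace IsLazyReversible

variable (C : IsLazyReversible P π)
include C

lemma hitEnergy_nonneg (i : ℕ) : 0 ≤ hitEnergy P π i :=
  Finset.sum_nonneg fun _ _ => add_nonneg (div_nonneg (sq_nonneg _) (C.cond_nonneg _))
    (div_nonneg (sq_nonneg _) (C.cond_nonneg _))

lemma hitMean_nonneg (m x : ℕ) : 0 ≤ hitMean P π m x :=
  Finset.sum_nonneg fun _ _ => div_nonneg (C.cdf_nonneg _) (C.cond_nonneg _)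

lemma hitVar_nonneg (m x : ℕ) : 0 ≤ hitVar P π m x :=
  Finset.sum_nonneg fun _ _ => div_nonneg (C.hitEnergy_nonneg _) (C.cond_nonneg _)

lemma resist_nonneg (m x : ℕ) : 0 ≤ resist P π m x :=
  Finset.sum_nonneg fun _ _ => div_nonneg (by norm_num) (C.cond_nonneg _)

/-- A function with prescribed decrements `a (i + 1) / cond (i + 1)` below `m`. -/
lemma generator_potential {m : ℕ} (hm : m ≤ n) {u a : ℕ → ℝ} (ha : a 0 = 0)
    (hu : ∀ i < m, u i = a (i + 1) / cond P π (i + 1) + u (i + 1)) (x : Fin (n + 1))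
    (hx : (x : ℕ) < m) :
    π x * (∑ y : Fin (n + 1), P x y * u y - u x) = a x - a (x + 1) := by
  rw [C.generator, hu x hx]
  have h1 := (C.cond_pos (j := x) (by omega)).ne'
  have e1 : cond P π (x + 1) * (u (x + 1) - (a (x + 1) / cond P π (x + 1) + u (x + 1))) =
      - a (x + 1) := by
    field_simp
    ring
  rw [e1]
  rcases Nat.eq_zero_or_pos (x : ℕ) with h | h
  · rw [h, cond_zero, ha]; ring
  · obtain ⟨z, hz⟩ : ∃ z, (x : ℕ) = z + 1 := ⟨x - 1, by omega⟩
    have h2 := (C.cond_pos (j := z) (by omega)).ne'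
    have e2 := hu z (by omega)
    rw [← hu x hx, hz, Nat.add_sub_cancel, e2]
    field_simp
    ring

/-- The decrements of `hitMean` make the flow across each edge equal to the mass to its left, so the
divergence at `x` is `-π x`. -/
lemma hitMean_step {m : ℕ} (hm : m ≤ n) (x : Fin (n + 1)) (hx : (x : ℕ) < m) :
    ∑ y : Fin (n + 1), P x y * hitMean P π m y = hitMean P π m x - 1 := by
  have h := C.generator_potential hm (u := hitMean P π m) (a := cdf π) cdf_zero
    (fun i hi => hitMean_of_lt hi) x hx
  rw [cdf_succ, mass_coe] at h
  have h2 : π x * (∑ y : Fin (n + 1), P x y * hitMean P π m y - hitMean P π m x + 1) = 0 := by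
    linarith
  have := (mul_eq_zero.1 h2).resolve_left (C.pos x).ne'
  linarith

/-- The increments of `hitEnergy` are `π x` times the one-step quadratic variation of `hitMean`, so
`hitVar` compensates it; the proof gives equality. -/
lemma hitVar_step {m : ℕ} (hm : m ≤ n) (x : Fin (n + 1)) (hx : (x : ℕ) < m) :
    ∑ y : Fin (n + 1), P x y * hitVar P π m y +
      ∑ y : Fin (n + 1), P x y * (hitMean P π m y - hitMean P π m x) ^ 2 ≤ hitVar P π m x := by
  have h := C.generator_potential hm (u := hitVar P π m) (a := hitEnergy P π)
    (by simp [hitEnergy]) (fun i hi => hitVar_of_lt hi) x hx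
  have hsq := C.mul_sum_of_eq_zero (fun j => (hitMean P π m j - hitMean P π m x) ^ 2) x (by simp)
  have hc := (C.cond_pos (j := x) (by omega)).ne'
  have e1 : cond P π (x + 1) * (hitMean P π m (x + 1) - hitMean P π m x) ^ 2 =
      cdf π (x + 1) ^ 2 / cond P π (x + 1) := by
    rw [hitMean_of_lt hx]
    field_simp
    ring
  have e2 : cond P π x * (hitMean P π m (x - 1) - hitMean P π m x) ^ 2 =
      cdf π x ^ 2 / cond P π x := by
    rcases Nat.eq_zero_or_pos (x : ℕ) with h0 | h0
    -- There is no edge to the left of `0`; the term `0 / 0` takes the value `0`, as it does in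
    -- `hitEnergy`.
    · rw [h0, cond_zero, cdf_zero]; simp
    · obtain ⟨z, hz⟩ : ∃ z, (x : ℕ) = z + 1 := ⟨x - 1, by omega⟩
      have hc' := (C.cond_pos (j := z) (by omega)).ne'
      rw [hz, Nat.add_sub_cancel, hitMean_of_lt (x := z) (by omega)]
      field_simp
      ring
  have e3 : hitEnergy P π (x + 1) = hitEnergy P π x +
      (cdf π (x + 1) ^ 2 / cond P π (x + 1) + cdf π x ^ 2 / cond P π x) := by
    rw [hitEnergy, Finset.sum_range_succ, hitEnergy]
  have h2 : π x * (∑ y : Fin (n + 1), P x y * hitVar P π m y +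
      ∑ y : Fin (n + 1), P x y * (hitMean P π m y - hitMean P π m x) ^ 2 - hitVar P π m x) = 0 := by
    linarith
  have := (mul_eq_zero.1 h2).resolve_left (C.pos x).ne'
  linarith

/-- One step of the space-time supermartingale `(s + hitMean) ^ 2 + hitVar`. -/
lemma quadratic_step {m : ℕ} (hm : m ≤ n) (x : Fin (n + 1)) (hx : (x : ℕ) < m) (s : ℝ) :
    ∑ y : Fin (n + 1), P x y * ((s + 1 + hitMean P π m y) ^ 2 + hitVar P π m y) ≤
      (s + hitMean P π m x) ^ 2 + hitVar P π m x := by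
  have h1 := C.hitMean_step hm x hx
  have h2 := C.hitVar_step hm x hx
  -- Expand the square around `hitMean P π m x`: the drift `-1` cancels the advance of the clock
  -- `s`, and `hitVar` pays for the quadratic term. A surplus of `-1` is dropped.
  have h3 : ∀ y : Fin (n + 1), P x y * ((s + 1 + hitMean P π m y) ^ 2 + hitVar P π m y) =
      P x y * ((s + 1 + hitMean P π m x) ^ 2 - 2 * (s + 1 + hitMean P π m x) * hitMean P π m x) +
      2 * (s + 1 + hitMean P π m x) * (P x y * hitMean P π m y) +
      (P x y * hitVar P π m y + P x y * (hitMean P π m y - hitMean P π m x) ^ 2) := by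
    intro y
    ring
  rw [Finset.sum_congr rfl fun y _ => h3 y, Finset.sum_add_distrib, Finset.sum_add_distrib,
    ← Finset.sum_mul, C.sum_row, ← Finset.mul_sum, h1, Finset.sum_add_distrib]
  nlinarith

lemma pow_below_nonneg (t k : ℕ) (x : Fin (n + 1)) : 0 ≤ (P ^ t *ᵥ below n k) x := by
  change 0 ≤ ∑ y, (P ^ t) x y * below n k y
  refine Finset.sum_nonneg fun y _ => mul_nonneg (C.pow_nonneg t x y) ?_
  rw [below]
  split_ifs <;> norm_num

lemma pow_below_le_one (t k : ℕ) (x : Fin (n + 1)) : (P ^ t *ᵥ below n k) x ≤ 1 := by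
  rw [← C.sum_pow_row t x]
  change ∑ y, (P ^ t) x y * below n k y ≤ ∑ y, (P ^ t) x y
  refine Finset.sum_le_sum fun y _ => mul_le_of_le_one_right (C.pow_nonneg t x y) ?_
  rw [below]
  split_ifs <;> norm_num

/-- Chebyshev bound for not having passed `m` long after the mean hitting time. -/
lemma late_bound {m : ℕ} (hm : m ≤ n) {k : ℕ} {ρ A : ℝ} (hA : 0 ≤ A) (hρ : 0 ≤ ρ)
    (hk : ∀ t : ℕ, ∀ x : Fin (n + 1), m ≤ (x : ℕ) → (P ^ t *ᵥ below n k) x ≤ ρ)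
    (t : ℕ) (s : ℝ) (hs : A ≤ s + t) (x : Fin (n + 1)) :
    ((P ^ t *ᵥ below n k) x - ρ) * A ^ 2 ≤
      (s + hitMean P π m x) ^ 2 + hitVar P π m x := by
  have habove : ∀ (t : ℕ) (s : ℝ) (x : Fin (n + 1)), m ≤ (x : ℕ) →
      ((P ^ t *ᵥ below n k) x - ρ) * A ^ 2 ≤ (s + hitMean P π m x) ^ 2 + hitVar P π m x := by
    intro t s x hx
    have h1 : ((P ^ t *ᵥ below n k) x - ρ) * A ^ 2 ≤ 0 :=
      mul_nonpos_of_nonpos_of_nonneg (by linarith [hk t x hx]) (sq_nonneg A)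
    linarith [sq_nonneg (s + hitMean P π m x), C.hitVar_nonneg m x]
  induction t generalizing s x with
  | zero =>
    have hb : (P ^ 0 *ᵥ below n k) x ≤ 1 := by
      rw [pow_zero, Matrix.one_mulVec, below]
      split_ifs <;> norm_num
    -- When time runs out the clock shows at least `A`, and the remaining mean only adds to it.
    have hs' : A ≤ s + hitMean P π m x := by
      have := C.hitMean_nonneg m x
      simp only [Nat.cast_zero, add_zero] at hs
      linarith
    have h2 : A ^ 2 ≤ (s + hitMean P π m x) ^ 2 := pow_le_pow_left₀ hA hs' 2
    have h3 : ((P ^ 0 *ᵥ below n k) x - ρ) * A ^ 2 ≤ 1 * A ^ 2 :=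
      mul_le_mul_of_nonneg_right (by linarith) (sq_nonneg A)
    linarith [C.hitVar_nonneg m x]
  | succ t ih =>
    rcases le_or_gt m (x : ℕ) with hx | hx
    · exact habove _ s x hx
    · refine le_trans (le_of_eq_of_le ?_ (Finset.sum_le_sum fun y _ =>
        mul_le_mul_of_nonneg_left (ih (s + 1) (by push_cast at hs; linarith) y) (C.nonneg x y)))
        (C.quadratic_step hm x hx s)
      rw [pow_succ_mulVec]
      simp_rw [← mul_assoc, mul_sub]
      rw [← Finset.sum_mul, Finset.sum_sub_distrib, ← Finset.sum_mul, C.sum_row, one_mul]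

/-- Chebyshev bound for having passed `m` long before the mean hitting time. -/
lemma early_bound {m : ℕ} (hm : m ≤ n) {A : ℝ} (hA : 0 ≤ A) (t : ℕ) (s : ℝ) (hs : s + t ≤ -A)
    (x : Fin (n + 1)) :
    (1 - (P ^ t *ᵥ below n m) x) * A ^ 2 ≤ (s + hitMean P π m x) ^ 2 + hitVar P π m x := by
  have habove : ∀ (t : ℕ) (s : ℝ) (x : Fin (n + 1)), s + t ≤ -A → m ≤ (x : ℕ) →
      (1 - (P ^ t *ᵥ below n m) x) * A ^ 2 ≤ (s + hitMean P π m x) ^ 2 + hitVar P π m x := by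
    intro t s x hs hx
    have ht : (0 : ℝ) ≤ t := Nat.cast_nonneg t
    -- On arrival at `m` the remaining mean is zero and the clock still shows at most `-A`.
    have h1 : A ^ 2 ≤ (-s) ^ 2 := pow_le_pow_left₀ hA (by linarith) 2
    have h2 : (1 - (P ^ t *ᵥ below n m) x) * A ^ 2 ≤ 1 * A ^ 2 :=
      mul_le_mul_of_nonneg_right (by linarith [C.pow_below_nonneg t m x]) (sq_nonneg A)
    rw [hitMean_of_le hx]
    nlinarith [C.hitVar_nonneg m x]
  induction t generalizing s x with
  | zero =>
    rcases le_or_gt m (x : ℕ) with hx | hx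
    · exact habove 0 s x hs hx
    · have hb : (P ^ 0 *ᵥ below n m) x = 1 := by
        rw [pow_zero, Matrix.one_mulVec, below, if_pos hx]
      rw [hb, sub_self, zero_mul]
      linarith [sq_nonneg (s + hitMean P π m x), C.hitVar_nonneg m x]
  | succ t ih =>
    rcases le_or_gt m (x : ℕ) with hx | hx
    · exact habove _ s x hs hx
    · refine le_trans (le_of_eq_of_le ?_ (Finset.sum_le_sum fun y _ =>
        mul_le_mul_of_nonneg_left (ih (s + 1) (by push_cast at hs; linarith) y) (C.nonneg x y)))
        (C.quadratic_step hm x hx s)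
      rw [pow_succ_mulVec]
      simp_rw [← mul_assoc, mul_sub, mul_one]
      rw [← Finset.sum_mul, Finset.sum_sub_distrib, C.sum_row]

/-- Average the probability over a stationary start: starts `y ≤ m` contribute at least the value at
`x` by monotonicity, the others at least zero. -/
lemma cdf_mul_pow_below_le {m : ℕ} (k t : ℕ) (hk : k ≤ n + 1) (x : Fin (n + 1))
    (hx : m ≤ (x : ℕ)) : cdf π (m + 1) * (P ^ t *ᵥ below n k) x ≤ cdf π k := by
  have hm : m + 1 ≤ n + 1 := by omega
  have e : cdf π k = ∑ y, π y * (P ^ t *ᵥ below n k) y := by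
    simp_rw [Matrix.mulVec, dotProduct, Finset.mul_sum]
    rw [Finset.sum_comm, cdf_eq_sum hk]
    simp_rw [← mul_assoc, ← Finset.sum_mul, C.stationary_pow]
  rw [e, cdf_eq_sum hm, Finset.sum_mul]
  refine Finset.sum_le_sum fun y _ => ?_
  rw [mul_assoc]
  refine mul_le_mul_of_nonneg_left ?_ (C.pos y).le
  have hnn := C.pow_below_nonneg t k y
  by_cases hy : (y : ℕ) < m + 1
  · have := C.pow_below_antitone t k (Fin.le_def.2 (by omega : (y : ℕ) ≤ x))
    simpa [below, hy] using this
  · simpa [below, hy] using hnn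

/-- Mixing from the left end after the hitting time of a high quantile. -/
lemma pow_below_sub_cdf_le {m : ℕ} (hm : m ≤ n) {δ A : ℝ} (hA : 0 < A)
    (hδ : 1 - δ ≤ cdf π (m + 1)) {t : ℕ} (ht : hitMean P π m 0 + A ≤ t) {k : ℕ}
    (hk : k ≤ n + 1) :
    (P ^ t *ᵥ below n k) 0 - cdf π k ≤ hitVar P π m 0 / A ^ 2 + δ := by
  have hv : 0 ≤ hitVar P π m 0 / A ^ 2 := div_nonneg (C.hitVar_nonneg _ _) (sq_nonneg A)
  -- For `k > m` the segment already has mass at least `1 - δ`, and nothing about the chain is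
  -- needed.
  rcases le_or_gt (m + 1) k with hmk | hmk
  · have h1 := C.cdf_mono hmk
    have h2 := C.pow_below_le_one t k 0
    linarith
  · have hpos := C.cdf_succ_pos hm
    have h1 := C.late_bound hm (k := k) (ρ := cdf π k / cdf π (m + 1)) hA.le
      (div_nonneg (C.cdf_nonneg _) hpos.le)
      (fun t x hx => by
        rw [le_div_iff₀ hpos, mul_comm]
        exact C.cdf_mul_pow_below_le k t hk x hx)
      t (-hitMean P π m 0) (by linarith) 0
    simp only [Fin.val_zero, neg_add_cancel] at h1
    have h2 : (P ^ t *ᵥ below n k) 0 - cdf π k / cdf π (m + 1) ≤ hitVar P π m 0 / A ^ 2 := by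
      rw [le_div_iff₀ (by positivity)]
      linarith
    -- Dividing costs `(cdf k / cdf (m + 1)) (1 - cdf (m + 1))`, at most `δ` because `k ≤ m + 1`.
    have h3 : cdf π k / cdf π (m + 1) ≤ cdf π k + δ := by
      rw [div_le_iff₀ hpos]
      have h4 := C.cdf_mono hmk.le
      have h5 := C.cdf_le_one (k := m + 1) (by omega)
      have h6 := C.cdf_nonneg k
      nlinarith
    linarith

lemma tvDist_ge {q : Fin (n + 1) → ℝ} (hq : ∑ x, q x = 1) {m : ℕ} (hm : m ≤ n + 1) :
    q ⬝ᵥ below n m - cdf π m ≤ tvDist q π := by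
  rw [cdf_eq_sum hm, tvDist]
  -- Subtracting half of `∑ (q - π) = 0` turns each term into `±(q x - π x) / 2`.
  have h1 : q ⬝ᵥ below n m - ∑ x, π x * below n m x =
      ∑ x, ((q x - π x) * below n m x - 1 / 2 * (q x - π x)) := by
    rw [Finset.sum_sub_distrib, ← Finset.mul_sum, Finset.sum_sub_distrib, hq, C.sum_one]
    simp_rw [sub_mul]
    rw [Finset.sum_sub_distrib]
    simp [dotProduct]
  rw [h1, Finset.mul_sum]
  refine Finset.sum_le_sum fun x _ => ?_
  rw [below]
  split_ifs
  · linarith [le_abs_self (q x - π x)]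
  · linarith [neg_abs_le (q x - π x)]

/-- No mixing before the hitting time of a low quantile. -/
lemma tvDist_zero_ge {m : ℕ} (hm : m ≤ n) {A : ℝ} (hA : 0 < A) {t : ℕ}
    (ht : t ≤ hitMean P π m 0 - A) :
    1 - cdf π m - hitVar P π m 0 / A ^ 2 ≤ tvDist ((P ^ t) 0) π := by
  have h1 := C.early_bound hm hA.le t (-hitMean P π m 0) (by linarith) 0
  simp only [Fin.val_zero, neg_add_cancel] at h1
  have h2 : 1 - (P ^ t *ᵥ below n m) 0 ≤ hitVar P π m 0 / A ^ 2 := by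
    rw [le_div_iff₀ (by positivity)]
    linarith
  have h3 : (P ^ t *ᵥ below n m) 0 - cdf π m ≤ tvDist ((P ^ t) 0) π :=
    C.tvDist_ge (C.sum_pow_row t 0) (by omega)
  linarith

/-- The mean hitting time is controlled by the probability of having arrived at a fixed time. -/
lemma hitMean_le_add_mul {m : ℕ} (hm : m ≤ n) (t : ℕ) (x : Fin (n + 1)) :
    hitMean P π m x ≤ t + hitMean P π m 0 * (P ^ t *ᵥ below n m) x := by
  have hanti : ∀ x : Fin (n + 1), hitMean P π m x ≤ hitMean P π m 0 := fun x =>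
    Finset.sum_le_sum_of_subset_of_nonneg (Finset.Ico_subset_Ico_left (Nat.zero_le _))
      fun _ _ _ => div_nonneg (C.cdf_nonneg _) (C.cond_nonneg _)
  induction t generalizing x with
  | zero =>
    rw [pow_zero, Matrix.one_mulVec, below]
    split_ifs with h
    · simpa using hanti x
    · rw [hitMean_of_le (by omega)]; simp
  | succ t ih =>
    rcases lt_or_ge (x : ℕ) m with hx | hx
    · have h1 := C.hitMean_step hm x hx
      have h2 : ∑ y : Fin (n + 1), P x y * hitMean P π m y ≤
          ∑ y, P x y * (t + hitMean P π m 0 * (P ^ t *ᵥ below n m) y) :=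
        Finset.sum_le_sum fun y _ => mul_le_mul_of_nonneg_left (ih y) (C.nonneg x y)
      have h3 : ∑ y, P x y * (t + hitMean P π m 0 * (P ^ t *ᵥ below n m) y) =
          t + hitMean P π m 0 * (P ^ (t + 1) *ᵥ below n m) x := by
        rw [pow_succ_mulVec, Finset.mul_sum]
        simp_rw [mul_add]
        rw [Finset.sum_add_distrib, ← Finset.sum_mul, C.sum_row, one_mul]
        congr 1
        exact Finset.sum_congr rfl fun y _ => by ring
      push_cast
      linarith
    · rw [hitMean_of_le hx]
      exact add_nonneg (Nat.cast_nonneg _)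
        (mul_nonneg (C.hitMean_nonneg _ _) (C.pow_below_nonneg _ _ _))

lemma exists_quantile {δ : ℝ} (h0 : 0 < δ) (h1 : δ ≤ 1) :
    ∃ m ≤ n, cdf π m ≤ δ ∧ δ ≤ cdf π (m + 1) := by
  classical
  have hex : ∃ k, δ ≤ cdf π (k + 1) := ⟨n, by rw [C.cdf_top]; exact h1⟩
  refine ⟨Nat.find hex, Nat.find_le (by rw [C.cdf_top]; exact h1), ?_, Nat.find_spec hex⟩
  rcases Nat.eq_zero_or_pos (Nat.find hex) with h | h
  · rw [h, cdf_zero]; exact h0.le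
  · have := Nat.find_min hex (m := Nat.find hex - 1) (by omega)
    rw [Nat.sub_add_cancel h] at this
    exact (not_le.1 this).le

/-- Convergence from the left end, uniformly over initial segments. -/
lemma exists_forall_pow_below_sub_cdf_le {η : ℝ} (hη : 0 < η) :
    ∃ T : ℕ, ∀ t ≥ T, ∀ k ≤ n + 1, (P ^ t *ᵥ below n k) 0 - cdf π k ≤ η := by
  obtain ⟨m, hm, -, hδ⟩ := C.exists_quantile (δ := max (1 - η / 2) (1 / 2))
    (lt_max_of_lt_right (by norm_num)) (max_le (by linarith) (by norm_num))
  -- `A` exceeds both `hitVar` and `2 / η`, hence `hitVar / A ^ 2 ≤ 1 / A ≤ η / 2`.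
  set A := 1 + hitVar P π m 0 + 2 / η with hAdef
  have hv := C.hitVar_nonneg m 0
  have hA : 0 < A := by positivity
  obtain ⟨T, hT⟩ := exists_nat_ge (hitMean P π m 0 + A)
  refine ⟨T, fun t ht k hk => ?_⟩
  have h1 := C.pow_below_sub_cdf_le hm hA (δ := η / 2) ((le_max_left _ _).trans hδ) (t := t)
    (hT.trans (by exact_mod_cast ht)) hk
  have h2 : hitVar P π m 0 / A ^ 2 ≤ η / 2 := by
    rw [div_le_iff₀ (by positivity)]
    have h3 : hitVar P π m 0 ≤ A := by
      have : 0 < 2 / η := by positivity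
      linarith
    have h4 : 1 ≤ η / 2 * A := by
      have : η / 2 * (2 / η) = 1 := by field_simp
      nlinarith
    nlinarith
  linarith

/-- The chain converges to its stationary distribution. -/
lemma exists_worstDist_le {η : ℝ} (hη : 0 < η) : ∃ t, worstDist P π t ≤ η := by
  obtain ⟨T, hT⟩ := C.exists_forall_pow_below_sub_cdf_le (half_pos hη)
  obtain ⟨T', hT'⟩ := C.reflect.exists_forall_pow_below_sub_cdf_le (half_pos hη)
  refine ⟨max T T', ?_⟩
  have := worstDist_le_of_ends C (hT _ (le_max_left T T')) (hT' _ (le_max_right T T'))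
  linarith

end IsLazyReversible

end BirthDeath

/-! ### Poincaré inequality, effective resistance, and the one-sided window. -/

namespace BirthDeath

open scoped Matrix

variable {n : ℕ}

/-- The Poincaré inequality with constant `R`: the variance is at most `R` times the energy. -/
def HasPoincare (P : Matrix (Fin (n + 1)) (Fin (n + 1)) ℝ) (π : Fin (n + 1) → ℝ) (R : ℝ) : Prop :=
  ∀ f : Fin (n + 1) → ℝ, ∃ c : ℝ,
    ∑ x, π x * (f x - c) ^ 2 ≤ R * ∑ x, π x * f x * (f x - ∑ y, P x y * f y)

variable {P : Matrix (Fin (n + 1)) (Fin (n + 1)) ℝ} {π : Fin (n + 1) → ℝ}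

lemma HasPoincare.reflect {R : ℝ} (h : HasPoincare P π R) :
    HasPoincare (P.submatrix Fin.rev Fin.rev) (π ∘ Fin.rev) R := by
  intro f
  obtain ⟨c, hc⟩ := h (f ∘ Fin.rev)
  refine ⟨c, ?_⟩
  rw [← sum_fin_rev fun x => π x * ((f ∘ Fin.rev) x - c) ^ 2,
    ← sum_fin_rev fun x => π x * (f ∘ Fin.rev) x * ((f ∘ Fin.rev) x -
      ∑ y, P x y * (f ∘ Fin.rev) y)] at hc
  have e : ∀ x : Fin (n + 1), ∑ y, P x.rev y * f y.rev =
      ∑ y, (P.submatrix Fin.rev Fin.rev) x y * f y := by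
    intro x
    rw [← sum_fin_rev fun y => P x.rev y * f y.rev]
    simp
  simp only [Function.comp_apply, Fin.rev_rev, e] at hc
  exact hc

lemma resist_of_le {m x : ℕ} (h : m ≤ x) : resist P π m x = 0 := by
  simp [resist, Finset.Ico_eq_empty_of_le h]

namespace IsLazyReversible

variable (C : IsLazyReversible P π)
include C

lemma one_sub_cdf_pos {m : ℕ} (hm : m ≤ n) : 0 < 1 - cdf π m := by
  have h1 := C.cdf_le_one (k := m + 1) (by omega)
  rw [cdf_succ] at h1
  linarith [C.mass_pos hm]

lemma resist_pos {i m : ℕ} (hi : i < m) (hm : m ≤ n) : 0 < resist P π m i := by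
  rw [resist_of_lt hi]
  have := C.resist_nonneg m (i + 1)
  have := C.cond_pos (j := i) (by omega)
  positivity

/-- The Poincaré inequality tested on the potential between `i` and `m`. -/
lemma exists_resist_bound {R : ℝ} (hR : HasPoincare P π R) {i m : ℕ} (hi : i < m) (hm : m ≤ n) :
    ∃ c : ℝ, cdf π (i + 1) * (resist P π m i - c) ^ 2 + (1 - cdf π m) * c ^ 2 ≤
      R * resist P π m i := by
  -- The potential of a unit flow from `i` to `m`: constant up to `i`, zero from `m` on, harmonic in
  -- between. Its energy is the resistance, all of it collected at `i`, since `u` vanishes at the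
  -- sink `m`.
  set u : ℕ → ℝ := fun j => resist P π m (max j i) with hu
  obtain ⟨c, hc⟩ := hR fun x => u x
  refine ⟨c, ?_⟩
  have hflow : ∀ j, cond P π j * (u j - u (j - 1)) = if i < j ∧ j ≤ m then -1 else 0 := by
    intro j
    rcases Nat.eq_zero_or_pos j with rfl | h0
    · simp
    obtain ⟨z, rfl⟩ : ∃ z, j = z + 1 := ⟨j - 1, by omega⟩
    simp only [Nat.add_sub_cancel, hu]
    split_ifs with h
    · have hc' := (C.cond_pos (j := z) (by omega)).ne'
      rw [max_eq_left (by omega : i ≤ z + 1), max_eq_left (by omega : i ≤ z),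
        resist_of_lt (by omega : z < m)]
      field_simp
      ring
    · rcases le_or_gt (z + 1) i with h1 | h1
      · rw [max_eq_right h1, max_eq_right (by omega : z ≤ i)]; ring
      · rw [max_eq_left (by omega : i ≤ z + 1), max_eq_left (by omega : i ≤ z),
          resist_of_le (by omega), resist_of_le (by omega)]
        ring
  have henergy : ∑ x : Fin (n + 1), π x * u x * (u x - ∑ y : Fin (n + 1), P x y * u y) =
      resist P π m i := by
    have h1 : ∀ x : Fin (n + 1), π x * u x * (u x - ∑ y : Fin (n + 1), P x y * u y) =
        if x = ⟨i, by omega⟩ then resist P π m i else 0 := by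
      intro x
      have h2 := C.generator u x
      have h3 := hflow (x + 1)
      rw [Nat.add_sub_cancel] at h3
      rw [h3, hflow x] at h2
      have h4 : π x * u x * (u x - ∑ y : Fin (n + 1), P x y * u y) =
          -(u x * (π x * (∑ y : Fin (n + 1), P x y * u y - u x))) := by ring
      rw [h4, h2]
      by_cases hx : (x : ℕ) = i
      · rw [if_pos (Fin.ext hx), if_pos (by omega), if_neg (by omega), hx]
        simp [hu]
      · rw [if_neg (fun h => hx (congrArg Fin.val h))]
        by_cases hxm : (x : ℕ) = m
        · have : u x = 0 := resist_of_le (by omega)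
          rw [this]; ring
        · by_cases h5 : i < (x : ℕ) ∧ (x : ℕ) ≤ m
          · rw [if_pos h5, if_pos (by omega)]; ring
          · rw [if_neg h5, if_neg (by omega)]; ring
    rw [Finset.sum_congr rfl fun x _ => h1 x]
    simp
  rw [henergy] at hc
  refine le_trans ?_ hc
  -- Only the states outside the open interval from `i` to `m`, where `u` is constant, are kept in
  -- the variance.
  have e : cdf π (i + 1) * (resist P π m i - c) ^ 2 + (1 - cdf π m) * c ^ 2 =
      ∑ x, π x * (below n (i + 1) x * (resist P π m i - c) ^ 2 + (1 - below n m x) * c ^ 2) := by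
    have h1 : 1 - cdf π m = ∑ x, π x * (1 - below n m x) := by
      simp_rw [mul_sub, mul_one]
      rw [Finset.sum_sub_distrib, C.sum_one, cdf_eq_sum (by omega)]
    rw [h1, cdf_eq_sum (by omega), Finset.sum_mul, Finset.sum_mul, ← Finset.sum_add_distrib]
    exact Finset.sum_congr rfl fun x _ => by ring
  rw [e]
  refine Finset.sum_le_sum fun x _ => mul_le_mul_of_nonneg_left ?_ (C.pos x).le
  simp only [below, hu]
  by_cases h1 : (x : ℕ) < i + 1
  · rw [if_pos h1, if_pos (by omega), max_eq_right (by omega)]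
    linarith
  · rw [if_neg h1]
    by_cases h2 : (x : ℕ) < m
    · rw [if_pos h2]
      nlinarith [sq_nonneg (resist P π m (max x i) - c)]
    · rw [if_neg h2, resist_of_le (x := max (x : ℕ) i) (by omega)]
      linarith

/-- With weights `F`, `B` and resistance `G`, the minimum of `F (G - c)² + B c²` over `c` is `F B G²
/ (F + B)`, and `F + B ≤ 1`. -/
lemma cdf_mul_resist_le {R : ℝ} (hR : HasPoincare P π R) {i m : ℕ} (hi : i < m) (hm : m ≤ n) :
    cdf π (i + 1) * resist P π m i * (1 - cdf π m) ≤ R := by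
  obtain ⟨c, hc⟩ := C.exists_resist_bound hR hi hm
  have hG := C.resist_pos hi hm
  have hF := C.cdf_succ_pos (k := i) (by omega)
  have hB := C.one_sub_cdf_pos hm
  have hFB : cdf π (i + 1) + (1 - cdf π m) ≤ 1 := by linarith [C.cdf_mono (by omega : i + 1 ≤ m)]
  set F := cdf π (i + 1)
  set B := 1 - cdf π m
  set G := resist P π m i
  have h1 : F * G * B * G ≤ F * (G - c) ^ 2 + B * c ^ 2 := by
    have h2 : 0 ≤ F * (G - c) ^ 2 + B * c ^ 2 := by positivity
    nlinarith [sq_nonneg (F * (G - c) - B * c)]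
  exact le_of_mul_le_mul_right (h1.trans hc) hG

/-- With both weights at least `δ` the minimum over `c` is at least `δ G² / 2`. This is linear in
`δ`, where `cdf_mul_resist_le` would give only `δ²`. -/
lemma mul_resist_le {R : ℝ} (hR : HasPoincare P π R) {δ : ℝ} (hδ : 0 ≤ δ) {i m : ℕ} (hi : i < m)
    (hm : m ≤ n) (h1 : δ ≤ cdf π (i + 1)) (h2 : δ ≤ 1 - cdf π m) : δ * resist P π m i ≤ 2 * R := by
  obtain ⟨c, hc⟩ := C.exists_resist_bound hR hi hm
  have hG := C.resist_pos hi hm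
  have h3 := mul_le_mul_of_nonneg_right h1 (sq_nonneg (resist P π m i - c))
  have h4 := mul_le_mul_of_nonneg_right h2 (sq_nonneg c)
  refine le_of_mul_le_mul_right ?_ hG
  nlinarith [mul_nonneg hδ (sq_nonneg (resist P π m i - 2 * c))]

/-- Each edge enters the energy at most twice, once from each endpoint; exchanging the order of
summation then gathers the resistance from `j` to `m`. -/
lemma hitVar_le_sum {m : ℕ} : hitVar P π m 0 ≤
    ∑ j ∈ Finset.range m, 2 * (cdf π (j + 1) ^ 2 / cond P π (j + 1)) * resist P π m j := by
  have hE : ∀ i, hitEnergy P π (i + 1) ≤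
      ∑ j ∈ Finset.range (i + 1), 2 * (cdf π (j + 1) ^ 2 / cond P π (j + 1)) := by
    intro i
    have hnn : 0 ≤ cdf π (i + 1) ^ 2 / cond P π (i + 1) :=
      div_nonneg (sq_nonneg _) (C.cond_nonneg _)
    rw [hitEnergy, Finset.sum_add_distrib, ← Finset.mul_sum, Finset.sum_range_succ' (fun j =>
      cdf π j ^ 2 / cond P π j), cond_zero, div_zero,
      Finset.sum_range_succ (fun j => cdf π (j + 1) ^ 2 / cond P π (j + 1))]
    linarith
  calc hitVar P π m 0
      ≤ ∑ i ∈ Finset.Ico 0 m, ∑ j ∈ Finset.range (i + 1),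
          2 * (cdf π (j + 1) ^ 2 / cond P π (j + 1)) * (1 / cond P π (i + 1)) := by
        refine Finset.sum_le_sum fun i _ => ?_
        rw [← Finset.sum_mul, div_eq_mul_one_div]
        exact mul_le_mul_of_nonneg_right (hE i) (div_nonneg zero_le_one (C.cond_nonneg _))
    _ = ∑ j ∈ Finset.range m, ∑ i ∈ Finset.Ico j m,
          2 * (cdf π (j + 1) ^ 2 / cond P π (j + 1)) * (1 / cond P π (i + 1)) := by
        refine Finset.sum_comm' fun i j => ?_
        simp only [Finset.mem_Ico, Finset.mem_range]
        omega
    _ = _ := by simp_rw [← Finset.mul_sum]; rfl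

/-- The variance of a hitting time is at most its mean times the relaxation time, up to a factor
depending on the stationary mass of the target. -/
lemma hitVar_le {R : ℝ} (hR : HasPoincare P π R) {m : ℕ} (hm : m ≤ n) :
    (1 - cdf π m) * hitVar P π m 0 ≤ 2 * R * hitMean P π m 0 := by
  have hB := C.one_sub_cdf_pos hm
  refine (mul_le_mul_of_nonneg_left C.hitVar_le_sum hB.le).trans ?_
  rw [hitMean, ← Finset.range_eq_Ico, Finset.mul_sum, Finset.mul_sum]
  refine Finset.sum_le_sum fun j hj => ?_
  have h1 := C.cdf_mul_resist_le hR (Finset.mem_range.1 hj) hm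
  have h2 : 0 ≤ 2 * (cdf π (j + 1) / cond P π (j + 1)) :=
    mul_nonneg zero_le_two (div_nonneg (C.cdf_nonneg _) (C.cond_nonneg _))
  calc (1 - cdf π m) * (2 * (cdf π (j + 1) ^ 2 / cond P π (j + 1)) * resist P π m j)
      = 2 * (cdf π (j + 1) / cond P π (j + 1)) *
          (cdf π (j + 1) * resist P π m j * (1 - cdf π m)) := by ring
    _ ≤ 2 * (cdf π (j + 1) / cond P π (j + 1)) * R := mul_le_mul_of_nonneg_left h1 h2
    _ = _ := by ring

lemma hitMean_le_add_resist {a b : ℕ} (hab : a ≤ b) (hb : b ≤ n) :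
    hitMean P π b 0 ≤ hitMean P π a 0 + resist P π b a := by
  rw [hitMean, hitMean, ← Finset.sum_Ico_consecutive _ (Nat.zero_le a) hab, resist]
  gcongr with i hi
  · exact C.cond_nonneg _
  · rw [Finset.mem_Ico] at hi
    exact C.cdf_le_one (by omega)

set_option maxHeartbeats 1000000 in
/-- The window in which the chain started at the left end mixes. -/
lemma exists_window {ε R : ℝ} {T : ℕ} (hε₀ : 0 < ε) (hε : ε < 1 / 2) (hP : HasPoincare P π R)
    (hR : 1 ≤ R) (hRT : R ≤ 2 * T)
    (hT : ∀ k ≤ n + 1, (P ^ T *ᵥ below n k) 0 - cdf π k ≤ 1 / 4) :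
    ∃ U : ℝ, 0 ≤ U ∧ (∀ t : ℕ, U ≤ t → ∀ k ≤ n + 1, (P ^ t *ᵥ below n k) 0 - cdf π k ≤ ε / 2) ∧
      ∀ t : ℕ, t ≤ U - 34 * (√(R * T) / √ε ^ 3) → 1 - ε < tvDist ((P ^ t) 0) π := by
  obtain ⟨a, ha, ha1, ha2⟩ := C.exists_quantile (δ := ε / 4) (by linarith) (by linarith)
  obtain ⟨b, hb, hb1, hb2⟩ := C.exists_quantile (δ := 1 - ε / 4) (by linarith) (by linarith)
  have hab : a ≤ b := by
    by_contra! h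
    have := C.cdf_mono (by omega : b + 1 ≤ a)
    linarith
  have hTpos : (0 : ℝ) < T := by linarith
  set τ : ℝ := (T : ℝ) with hτ
  have hR0 : 0 < R := by linarith
  set r := √ε with hr
  have hrpos : 0 < r := Real.sqrt_pos.2 hε₀
  have hr2 : r ^ 2 = ε := Real.sq_sqrt hε₀.le
  set S := √(R * τ) with hS
  have hSpos : 0 < S := Real.sqrt_pos.2 (by positivity)
  have hS2 : S ^ 2 = R * τ := Real.sq_sqrt (by positivity)
  set W := S / r ^ 3 with hW
  have hWpos : 0 < W := by positivity
  have hW2 : W ^ 2 * ε ^ 3 = R * τ := by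
    rw [hW, ← hr2, ← hS2]
    field_simp
  have hma := C.hitMean_nonneg a 0
  have hmb := C.hitMean_nonneg b 0
  have hva := C.hitVar_nonneg a 0
  have hvb := C.hitVar_nonneg b 0
  -- At time `T` the chain is below `a` with probability at most `1/4 + ε/4 ≤ 3/8`, so the mean is
  -- at most `T` plus `3/8` of itself.
  have hea : hitMean P π a 0 ≤ 2 * τ := by
    have h1 := C.hitMean_le_add_mul ha T 0
    have h2 := hT a (by omega)
    simp only [Fin.val_zero] at h1
    nlinarith
  have hres : ε * resist P π b a ≤ 8 * R := by
    rcases hab.eq_or_lt with rfl | h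
    · rw [resist_of_le le_rfl]; linarith
    · have := C.mul_resist_le hP (δ := ε / 4) (by linarith) h hb ha2 (by linarith)
      linarith
  have hdiff := C.hitMean_le_add_resist hab hb
  have hresW : resist P π b a ≤ 8 * W := by
    -- This is `R² ε ≤ R T`, from `R ≤ 2 T` and `ε < 1/2`.
    have h1 : R * r ≤ S := by
      refine Real.le_sqrt_of_sq_le ?_
      rw [mul_pow, hr2]
      nlinarith
    have h2 : R / ε ≤ W := by
      rw [hW, ← hr2, div_le_div_iff₀ (by positivity) (by positivity)]
      have := mul_le_mul_of_nonneg_right h1 (sq_nonneg r)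
      linarith
    have h3 : resist P π b a ≤ 8 * R / ε := by
      rw [le_div_iff₀ hε₀]; linarith
    calc _ ≤ 8 * R / ε := h3
      _ = 8 * (R / ε) := by ring
      _ ≤ _ := by linarith
  -- The mass from `b` on is only known to be at least `ε/4`; this factor and the mean `O(T/ε)`
  -- account for the power of `ε` in `W`. The constant `24` serves `136 ≤ 24² / 4`.
  have hVb : hitVar P π b 0 / (24 * W) ^ 2 ≤ ε / 4 := by
    have h1 := C.hitVar_le hP hb
    have h2 : ε / 4 * hitVar P π b 0 ≤ 2 * R * hitMean P π b 0 :=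
      (mul_le_mul_of_nonneg_right (by linarith) hvb).trans h1
    have h3 : ε * hitMean P π b 0 ≤ 17 * τ := by nlinarith
    have h4 : ε ^ 2 * hitVar P π b 0 ≤ 136 * (W ^ 2 * ε ^ 3) := by
      rw [hW2]
      calc ε ^ 2 * hitVar P π b 0 = 4 * ε * (ε / 4 * hitVar P π b 0) := by ring
        _ ≤ 4 * ε * (2 * R * hitMean P π b 0) := by gcongr
        _ = 8 * R * (ε * hitMean P π b 0) := by ring
        _ ≤ 8 * R * (17 * τ) := by gcongr
        _ = _ := by ring
    have h5 : hitVar P π b 0 ≤ 136 * W ^ 2 * ε := by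
      refine le_of_mul_le_mul_left ?_ (pow_pos hε₀ 2)
      linarith
    rw [div_le_iff₀ (by positivity)]
    have h6 : 0 < W ^ 2 * ε := by positivity
    linarith
  have hVa : hitVar P π a 0 / (2 * W) ^ 2 < 3 * ε / 4 := by
    have h1 := C.hitVar_le hP ha
    have h2 : 7 / 8 * hitVar P π a 0 ≤ 2 * R * hitMean P π a 0 :=
      (mul_le_mul_of_nonneg_right (by linarith) hva).trans h1
    have h3 : 2 * R * hitMean P π a 0 ≤ 2 * R * (2 * τ) := by gcongr
    have h4 : hitVar P π a 0 ≤ 5 * (W ^ 2 * ε ^ 3) := by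
      rw [hW2]
      have : 0 < R * τ := by positivity
      linarith
    rw [div_lt_iff₀ (by positivity)]
    have h5 : 0 < W ^ 2 * ε := by positivity
    have h6 : ε ^ 2 < 1 / 2 := by nlinarith
    have h7 : W ^ 2 * ε * ε ^ 2 < W ^ 2 * ε * (1 / 2) := mul_lt_mul_of_pos_left h6 h5
    nlinarith
  -- The `34` is `24` for the deviation at `b`, `8` for the difference of the means and `2` for the
  -- deviation at `a`.
  refine ⟨hitMean P π b 0 + 24 * W, by positivity, fun t ht k hk => ?_, fun t ht => ?_⟩
  · have := C.pow_below_sub_cdf_le hb (A := 24 * W) (by positivity) (δ := ε / 4) hb2 ht hk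
    linarith
  · have := C.tvDist_zero_ge ha (A := 2 * W) (by positivity) (t := t) (by linarith)
    linarith

end IsLazyReversible

end BirthDeath

/-! ### From an irreducible birth-and-death chain to a positive reversible distribution. -/

namespace BirthDeath

open scoped Matrix

section Construction

variable {n : ℕ} {P : Matrix (Fin (n + 1)) (Fin (n + 1)) ℝ} {π : Fin (n + 1) → ℝ}

/-- An irreducible birth-and-death chain crosses every edge upwards. -/
lemma IsBirthDeathChain.up_pos (hBD : IsBirthDeathChain P) (hirr : P.IsIrreducible)
    (i j : Fin (n + 1)) (hij : (i : ℕ) + 1 = j) : 0 < P i j := by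
  refine lt_of_le_of_ne (hirr.nonneg i j) fun h0 => ?_
  have hcut : ∀ x y : Fin (n + 1), x ≤ i → i < y → P x y = 0 := by
    intro x y hx hy
    rw [Fin.le_def] at hx
    rw [Fin.lt_def] at hy
    by_cases h : (x : ℕ) + 1 < y
    · exact hBD.adjacent x y (Or.inl h)
    · have e1 : x = i := Fin.ext (by omega)
      have e2 : y = j := Fin.ext (by omega)
      rw [e1, e2, h0]
  have hpow : ∀ (k : ℕ) (x y : Fin (n + 1)), x ≤ i → i < y → (P ^ k) x y = 0 := by
    intro k
    induction k with
    | zero =>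
      intro x y hx hy
      rw [pow_zero, Matrix.one_apply_ne (hx.trans_lt hy).ne]
    | succ k ih =>
      intro x y hx hy
      rw [pow_succ', Matrix.mul_apply]
      refine Finset.sum_eq_zero fun z _ => ?_
      rcases le_or_gt z i with hz | hz
      · rw [ih z y hz hy, mul_zero]
      · rw [hcut x z hx hz, zero_mul]
  obtain ⟨k, -, hk⟩ := (Matrix.isIrreducible_iff_exists_pow_pos hirr.nonneg).1 hirr i j
  rw [hpow k i j le_rfl (Fin.lt_def.2 (by omega))] at hk
  exact lt_irrefl _ hk

lemma IsStationaryDistribution.vecMul_pow (hπ : IsStationaryDistribution P π) (k : ℕ) :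
    π ᵥ* P ^ k = π := by
  induction k with
  | zero => simp
  | succ k ih => rw [pow_succ, ← Matrix.vecMul_vecMul, ih, hπ.2]

lemma IsStationaryDistribution.pos (hπ : IsStationaryDistribution P π) (hirr : P.IsIrreducible)
    (y : Fin (n + 1)) : 0 < π y := by
  obtain ⟨x, hx⟩ : ∃ x, 0 < π x := by
    by_contra! h
    have h1 : ∑ x, π x ≤ 0 := Finset.sum_nonpos fun x _ => h x
    rw [hπ.1.2] at h1
    linarith
  have hpn : ∀ (k : ℕ) (x y : Fin (n + 1)), 0 ≤ (P ^ k) x y := by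
    intro k
    induction k with
    | zero =>
      intro x y
      rw [pow_zero, Matrix.one_apply]
      split_ifs <;> norm_num
    | succ k ih =>
      intro x y
      rw [pow_succ, Matrix.mul_apply]
      exact Finset.sum_nonneg fun z _ => mul_nonneg (ih x z) (hirr.nonneg z y)
  obtain ⟨k, -, hk⟩ := (Matrix.isIrreducible_iff_exists_pow_pos hirr.nonneg).1 hirr x y
  have e : ∑ z, π z * (P ^ k) z y = π y := congrFun (hπ.vecMul_pow k) y
  rw [← e]
  exact Finset.sum_pos' (fun z _ => mul_nonneg (hπ.1.1 z) (hpn k z y))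
    ⟨x, Finset.mem_univ x, mul_pos hx hk⟩

/-- The stationary flow across an edge vanishes. -/
lemma IsBirthDeathChain.balance_adjacent (hBD : IsBirthDeathChain P)
    (hπ : IsStationaryDistribution P π) (i j : Fin (n + 1)) (hij : (i : ℕ) + 1 = j) :
    π i * P i j = π j * P j i := by
  -- Stationarity tested on the indicator of the states below `j`: the net flow out of this segment
  -- is zero, and only the edge from `i` to `j` crosses its boundary.
  have hflow : ∑ x, ∑ y, π x * P x y * (below n j x - below n j y) = 0 := by
    simp_rw [mul_sub, Finset.sum_sub_distrib]
    rw [Finset.sum_comm (f := fun x y => π x * P x y * below n j y)]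
    simp_rw [← Finset.sum_mul, ← Finset.mul_sum,
      Matrix.sum_row_of_mem_rowStochastic hBD.stochastic, mul_one]
    rw [sub_eq_zero]
    refine Finset.sum_congr rfl fun x _ => ?_
    rw [show ∑ i, π i * P i x = π x from congrFun hπ.2 x]
  have hterm : ∀ x y : Fin (n + 1), π x * P x y * (below n j x - below n j y) =
      (if x = i then if y = j then π i * P i j else 0 else 0) -
        (if x = j then if y = i then π j * P j i else 0 else 0) := by
    intro x y
    by_cases hadj : (x : ℕ) + 1 < y ∨ (y : ℕ) + 1 < x
    · rw [hBD.adjacent x y hadj]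
      split_ifs <;> first | (subst_vars; omega) | ring
    · simp only [below]
      by_cases h1 : (x : ℕ) < j <;> by_cases h2 : (y : ℕ) < j
      · rw [if_pos h1, if_pos h2]
        split_ifs <;> first | (subst_vars; omega) | ring
      · have e1 : x = i := Fin.ext (by omega)
        have e2 : y = j := Fin.ext (by omega)
        have e3 : i ≠ j := by rintro rfl; omega
        subst e1 e2
        simp [h1, e3]
      · have e1 : x = j := Fin.ext (by omega)
        have e2 : y = i := Fin.ext (by omega)
        have e3 : j ≠ i := by rintro rfl; omega
        subst e1 e2
        simp [h2, e3]
      · rw [if_neg h1, if_neg h2]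
        split_ifs <;> first | (subst_vars; omega) | ring
  simp_rw [hterm, Finset.sum_sub_distrib] at hflow
  simp at hflow
  linarith

lemma IsBirthDeathChain.isLazyReversible (hBD : IsBirthDeathChain P) (hirr : P.IsIrreducible)
    (hlazy : IsLazy P) (hπ : IsStationaryDistribution P π) : IsLazyReversible P π where
  nonneg := hirr.nonneg
  sum_row := Matrix.sum_row_of_mem_rowStochastic hBD.stochastic
  adjacent := hBD.adjacent
  lazy := hlazy
  balance i j := by
    by_cases h1 : (i : ℕ) + 1 = j
    · exact hBD.balance_adjacent hπ i j h1
    by_cases h2 : (j : ℕ) + 1 = i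
    · exact (hBD.balance_adjacent hπ j i h2).symm
    by_cases h3 : i = j
    · rw [h3]
    · have h4 : (i : ℕ) ≠ j := fun h => h3 (Fin.ext h)
      rw [hBD.adjacent i j (by omega), hBD.adjacent j i (by omega)]
      simp
  pos := hπ.pos hirr
  sum_one := hπ.1.2
  up_pos := hBD.up_pos hirr

end Construction

/-! ### Eigenvalues, the Poincaré inequality, and relaxation time against mixing time. -/

section Spectral

/-- Expansion of a quadratic form in an orthonormal basis of eigenvectors. -/
lemma sum_eigenvalues_mul_sq {ι : Type*} [Fintype ι] [DecidableEq ι] {A : Matrix ι ι ℝ}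
    (hA : A.IsHermitian) (g : ι → ℝ) :
    ∑ i, ((hA.eigenvectorBasis i).ofLp ⬝ᵥ g) ^ 2 = g ⬝ᵥ g ∧
    ∑ i, hA.eigenvalues i * ((hA.eigenvectorBasis i).ofLp ⬝ᵥ g) ^ 2 = g ⬝ᵥ (A *ᵥ g) := by
  have hinner : ∀ x y : ι → ℝ, inner ℝ (WithLp.toLp 2 x) (WithLp.toLp 2 y) = x ⬝ᵥ y := by
    intro x y
    rw [EuclideanSpace.inner_toLp_toLp]
    simp [dotProduct_comm]
  have hexp : ∀ x y : ι → ℝ, ∑ i, ((hA.eigenvectorBasis i).ofLp ⬝ᵥ x) *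
      ((hA.eigenvectorBasis i).ofLp ⬝ᵥ y) = x ⬝ᵥ y := by
    intro x y
    rw [← hinner x y, ← hA.eigenvectorBasis.sum_inner_mul_inner]
    refine Finset.sum_congr rfl fun i _ => ?_
    rw [← hinner, ← hinner, real_inner_comm]
  refine ⟨by simpa only [sq] using hexp g g, ?_⟩
  rw [← hexp g (A *ᵥ g)]
  refine Finset.sum_congr rfl fun i _ => ?_
  have hT : Aᵀ = A := Matrix.conjTranspose_eq_transpose_of_trivial A ▸ hA
  rw [Matrix.dotProduct_mulVec, ← Matrix.mulVec_transpose, hT, hA.mulVec_eigenvectorBasis,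
    smul_dotProduct, smul_eq_mul]
  ring

variable {n : ℕ} {P : Matrix (Fin (n + 1)) (Fin (n + 1)) ℝ} {π : Fin (n + 1) → ℝ}

lemma tvDist_le_worstDist (P : Matrix (Fin (n + 1)) (Fin (n + 1)) ℝ) (π : Fin (n + 1) → ℝ)
    (t : ℕ) (x : Fin (n + 1)) :
    tvDist ((P ^ t) x) π ≤ worstDist P π t :=
  le_ciSup (f := fun x => tvDist ((P ^ t) x) π) (Set.finite_range _).bddAbove x

namespace IsLazyReversible

variable (C : IsLazyReversible P π)
include C

/-- Harmonic functions are constant. -/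
lemma eq_of_mulVec_eq_self {f : Fin (n + 1) → ℝ} (hf : P *ᵥ f = f) (x : Fin (n + 1)) :
    f x = f 0 := by
  set u : ℕ → ℝ := fun j => if h : j < n + 1 then f ⟨j, h⟩ else 0 with hu
  have hux : ∀ x : Fin (n + 1), u x = f x := fun x => dif_pos x.2
  have hgen : ∀ x : Fin (n + 1), cond P π (x + 1) * (u (x + 1) - u x) =
      cond P π x * (u x - u (x - 1)) := by
    intro x
    have h1 := C.generator u x
    simp_rw [hux] at h1
    rw [show ∑ y, P x y * f y = f x from congrFun hf x] at h1
    rw [hux]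
    linarith
  -- The flow of a harmonic function is the same across all edges, and it vanishes at the left end.
  have hflow : ∀ j ≤ n, cond P π (j + 1) * (u (j + 1) - u j) = 0 := by
    intro j
    induction j with
    | zero =>
      intro _
      simpa [cond_zero] using hgen 0
    | succ j ih =>
      intro hj
      have := hgen ⟨j + 1, by omega⟩
      simp only [Nat.add_sub_cancel] at this
      rw [this]
      exact ih (by omega)
  have hconst : ∀ j ≤ n, u j = u 0 := by
    intro j
    induction j with
    | zero => intro _; rfl
    | succ j ih =>
      intro hj
      have := (mul_eq_zero.1 (hflow j (by omega))).resolve_left (C.cond_pos (by omega)).ne'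
      linarith [ih (by omega)]
  have h0 := hux 0
  rw [← hux x, ← h0]
  exact hconst x (by omega)

/-- Nontrivial eigenvalues decay at least as fast as the distance to stationarity. -/
lemma abs_eigenvalue_pow_le {μ : ℝ} (hμ : Module.End.HasEigenvalue (Matrix.toLin' P) μ)
    (hμ1 : μ ≠ 1) (t : ℕ) : |μ| ^ t ≤ 2 * worstDist P π t := by
  obtain ⟨f, hf⟩ := hμ.exists_hasEigenvector
  have hfP : P *ᵥ f = μ • f := by
    have := hf.apply_eq_smul
    rwa [Matrix.toLin'_apply] at this
  have hpow : P ^ t *ᵥ f = μ ^ t • f := by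
    induction t with
    | zero => simp
    | succ t ih =>
      rw [pow_succ, ← Matrix.mulVec_mulVec, hfP, Matrix.mulVec_smul, ih, smul_smul]
      congr 1
      ring
  have hmean : ∑ x, π x * f x = 0 := by
    have h1 : ∑ x, π x * (P *ᵥ f) x = ∑ x, π x * f x := by
      simp_rw [Matrix.mulVec, dotProduct, Finset.mul_sum]
      rw [Finset.sum_comm]
      simp_rw [← mul_assoc, ← Finset.sum_mul, C.stationary]
    rw [hfP] at h1
    simp only [Pi.smul_apply, smul_eq_mul, mul_left_comm, ← Finset.mul_sum] at h1
    have h2 : (μ - 1) * ∑ x, π x * f x = 0 := by linarith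
    exact (mul_eq_zero.1 h2).resolve_left (sub_ne_zero.2 hμ1)
  obtain ⟨x, -, hx⟩ := Finset.exists_max_image Finset.univ (fun x => |f x|) Finset.univ_nonempty
  have hpos : 0 < |f x| := by
    by_contra! h
    refine hf.2 (funext fun y => ?_)
    exact abs_nonpos_iff.1 ((hx y (Finset.mem_univ y)).trans h)
  refine le_of_mul_le_mul_right ?_ hpos
  have e : μ ^ t * f x = ∑ y, ((P ^ t) x y - π y) * f y := by
    simp_rw [sub_mul]
    rw [Finset.sum_sub_distrib, hmean, sub_zero]
    exact (congrFun hpow x).symm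
  calc |μ| ^ t * |f x| = |∑ y, ((P ^ t) x y - π y) * f y| := by rw [← e, abs_mul, abs_pow]
    _ ≤ ∑ y, |((P ^ t) x y - π y) * f y| := Finset.abs_sum_le_sum_abs _ _
    _ ≤ ∑ y, |(P ^ t) x y - π y| * |f x| := by
        refine Finset.sum_le_sum fun y _ => ?_
        rw [abs_mul]
        exact mul_le_mul_of_nonneg_left (hx y (Finset.mem_univ y)) (abs_nonneg _)
    _ = 2 * tvDist ((P ^ t) x) π * |f x| := by
        rw [← Finset.sum_mul, tvDist]
        ring
    _ ≤ 2 * worstDist P π t * |f x| := by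
        have := tvDist_le_worstDist P π t x
        gcongr

/-- A bound on the nontrivial eigenvalues gives a Poincaré inequality. -/
lemma hasPoincare {l : ℝ} (hl : l < 1)
    (h : ∀ μ : ℝ, Module.End.HasEigenvalue (Matrix.toLin' P) μ → μ ≠ 1 → μ ≤ l) :
    HasPoincare P π (1 - l)⁻¹ := by
  intro f
  set c := ∑ x, π x * f x with hc
  refine ⟨c, ?_⟩
  set s : Fin (n + 1) → ℝ := fun x => √(π x) with hs
  have hs0 : ∀ x, s x ≠ 0 := fun x => (Real.sqrt_pos.2 (C.pos x)).ne'
  have hs2 : ∀ x, s x * s x = π x := fun x => Real.mul_self_sqrt (C.pos x).le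
  -- Conjugation by `√π` makes `P` symmetric by detailed balance, so the spectral theorem applies.
  set A : Matrix (Fin (n + 1)) (Fin (n + 1)) ℝ := Matrix.of fun x y => s x * P x y / s y with hAdef
  have hA : A.IsHermitian := by
    ext x y
    simp only [hAdef, Matrix.conjTranspose_apply, Matrix.of_apply, star_trivial]
    rw [div_eq_div_iff (hs0 x) (hs0 y)]
    have := C.balance y x
    rw [← hs2, ← hs2] at this
    linarith
  set g : Fin (n + 1) → ℝ := fun x => s x * (f x - c) with hg
  obtain ⟨h1, h2⟩ := sum_eigenvalues_mul_sq hA g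
  have hle : g ⬝ᵥ (A *ᵥ g) ≤ l * (g ⬝ᵥ g) := by
    rw [← h1, ← h2, Finset.mul_sum]
    refine Finset.sum_le_sum fun i _ => ?_
    set v : Fin (n + 1) → ℝ := (hA.eigenvectorBasis i).ofLp with hv
    set μ := hA.eigenvalues i with hμ
    have hAv : A *ᵥ v = μ • v := hA.mulVec_eigenvectorBasis i
    set w : Fin (n + 1) → ℝ := fun x => v x / s x with hw
    have hPw : P *ᵥ w = μ • w := by
      ext x
      have h3 : ∑ y, s x * P x y / s y * v y = μ * v x := congrFun hAv x
      simp only [Matrix.mulVec, dotProduct, Pi.smul_apply, smul_eq_mul, hw]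
      rw [mul_div_assoc', eq_div_iff (hs0 x), ← h3, Finset.sum_mul]
      exact Finset.sum_congr rfl fun y _ => by ring
    have hw0 : w ≠ 0 := by
      intro h0
      have hv0 : hA.eigenvectorBasis i = 0 := by
        ext x
        have := congrFun h0 x
        simp only [hw, Pi.zero_apply, div_eq_zero_iff, hs0 x, or_false] at this
        exact this
      exact hA.eigenvectorBasis.toBasis.ne_zero i (by simpa using hv0)
    by_cases hμ1 : μ = 1
    -- For eigenvalue `1` the vector `v` is a multiple of `√π`, orthogonal to `g` because `f - c`
    -- has mean zero.
    · have hconst := C.eq_of_mulVec_eq_self (f := w) (by rw [hPw, hμ1, one_smul])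
      have hzero : v ⬝ᵥ g = 0 := by
        have h4 : ∀ x, v x * g x = w 0 * (π x * f x - π x * c) := by
          intro x
          have h5 : v x = w 0 * s x := by
            rw [← hconst x, hw]
            field_simp [hs0 x]
          rw [h5, hg, ← hs2]
          ring
        rw [dotProduct, Finset.sum_congr rfl fun x _ => h4 x, ← Finset.mul_sum,
          Finset.sum_sub_distrib, ← Finset.sum_mul, C.sum_one, ← hc]
        ring
      rw [hzero]
      simp
    · refine mul_le_mul_of_nonneg_right (h μ ?_ hμ1) (sq_nonneg _)
      refine Module.End.hasEigenvalue_of_hasEigenvector (x := w) ?_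
      rw [Module.End.hasEigenvector_iff, Module.End.mem_eigenspace_iff]
      exact ⟨by rw [Matrix.toLin'_apply, hPw], hw0⟩
  have eg : g ⬝ᵥ g = ∑ x, π x * (f x - c) ^ 2 := by
    refine Finset.sum_congr rfl fun x _ => ?_
    rw [hg, ← hs2]
    ring
  have hPf : ∑ x, π x * ∑ y, P x y * f y = c := by
    simp_rw [Finset.mul_sum]
    rw [Finset.sum_comm]
    simp_rw [← mul_assoc, ← Finset.sum_mul, C.stationary]
    rfl
  have eA : g ⬝ᵥ g - g ⬝ᵥ (A *ᵥ g) = ∑ x, π x * f x * (f x - ∑ y, P x y * f y) := by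
    have h6 : ∀ x, (A *ᵥ g) x = s x * (∑ y, P x y * f y - c) := by
      intro x
      have h7 : ∀ y, A x y * g y = s x * (P x y * f y) - s x * c * P x y := by
        intro y
        simp only [hAdef, hg, Matrix.of_apply]
        field_simp [hs0 y]
      rw [Matrix.mulVec, dotProduct, Finset.sum_congr rfl fun y _ => h7 y,
        Finset.sum_sub_distrib, ← Finset.mul_sum, ← Finset.mul_sum, C.sum_row]
      ring
    have h8 : ∀ x, g x * g x - g x * (A *ᵥ g) x =
        π x * f x * (f x - ∑ y, P x y * f y) -
          (c * (π x * f x) - c * (π x * ∑ y, P x y * f y)) := by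
      intro x
      rw [h6, ← hs2]
      simp only [hg]
      ring
    rw [dotProduct, dotProduct, ← Finset.sum_sub_distrib, Finset.sum_congr rfl fun x _ => h8 x,
      Finset.sum_sub_distrib, Finset.sum_sub_distrib, ← Finset.mul_sum, ← Finset.mul_sum, hPf, ← hc]
    ring
  rw [← eA, ← eg, ← div_eq_inv_mul, le_div_iff₀ (by linarith)]
  linarith

lemma worstDist_tMix_le {η : ℝ} (hη : 0 < η) : worstDist P π (tMix P π η) ≤ η :=
  Nat.sInf_mem (C.exists_worstDist_le hη)

/-- At time zero the distance from `x` is `1 - π x`; two distinct states cannot both have mass at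
least `3/4`. -/
lemma one_le_tMix (hn : 1 ≤ n) : 1 ≤ tMix P π (1 / 4) := by
  rw [Nat.one_le_iff_ne_zero]
  intro h0
  have h1 := C.worstDist_tMix_le (η := 1 / 4) (by norm_num)
  rw [h0] at h1
  have h2 : ∀ x, 3 / 4 ≤ π x := by
    intro x
    have h3 := (tvDist_le_worstDist P π 0 x).trans h1
    rw [tvDist, pow_zero] at h3
    have h4 : ∑ y, |(1 : Matrix (Fin (n + 1)) (Fin (n + 1)) ℝ) x y - π y| ≥
        ∑ y, (2 * (if x = y then 1 - π y else 0) + (π y - if x = y then 1 else 0)) := by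
      refine Finset.sum_le_sum fun y _ => ?_
      rw [Matrix.one_apply]
      split_ifs with hxy
      · linarith [le_abs_self (1 - π y)]
      · linarith [neg_abs_le (0 - π y)]
    rw [Finset.sum_add_distrib, Finset.sum_sub_distrib, ← Finset.mul_sum, C.sum_one] at h4
    simp at h4
    linarith
  have hne : (0 : Fin (n + 1)) ≠ Fin.last n := by
    intro h
    have := congrArg Fin.val h
    simp at this
    omega
  have h5 : π 0 + π (Fin.last n) ≤ 1 := by
    rw [← Finset.sum_pair hne, ← C.sum_one]
    exact Finset.sum_le_sum_of_subset_of_nonneg (Finset.subset_univ _) fun j _ _ => (C.pos j).le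
  linarith [h2 0, h2 (Fin.last n)]

/-- The relaxation time is positive, at most twice the mixing time, and a Poincaré constant. -/
lemma tRel_bounds (hn : 1 ≤ n) :
    1 ≤ tRel P ∧ tRel P ≤ 2 * tMix P π (1 / 4) ∧ HasPoincare P π (tRel P) := by
  set T := tMix P π (1 / 4) with hT
  have hT1 : (1 : ℝ) ≤ T := by exact_mod_cast C.one_le_tMix hn
  have hworst := C.worstDist_tMix_le (η := 1 / 4) (by norm_num)
  have hbound : ∀ μ : ℝ, Module.End.HasEigenvalue (Matrix.toLin' P) μ → μ ≠ 1 →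
      |μ| ≤ 1 - 1 / (2 * T) := by
    intro μ hμ hμ1
    have h1 := C.abs_eigenvalue_pow_le hμ hμ1 T
    -- Bernoulli's inequality turns `|μ| ^ T ≤ 1/2` into the gap bound `T (1 - |μ|) ≥ 1/2`.
    have h2 := one_add_mul_le_pow (a := |μ| - 1) (by linarith [abs_nonneg μ]) T
    rw [add_sub_cancel] at h2
    have h3 : (T : ℝ) * (1 - |μ|) ≥ 1 / 2 := by linarith
    have h4 : 1 / (2 * (T : ℝ)) ≤ 1 - |μ| := by
      rw [div_le_iff₀ (by positivity)]
      linarith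
    linarith
  have hnn : (0 : ℝ) ≤ 1 - 1 / (2 * T) := by
    have : 1 / (2 * (T : ℝ)) ≤ 1 := by
      rw [div_le_one (by positivity)]
      linarith
    linarith
  have hub : ∀ r ∈ {r : ℝ | ∃ μ : ℝ, Module.End.HasEigenvalue (Matrix.toLin' P) μ ∧ μ ≠ 1 ∧
      r = |μ|}, r ≤ 1 - 1 / (2 * T) := by
    rintro r ⟨μ, hμ, hμ1, rfl⟩
    exact hbound μ hμ hμ1
  have hl0 : 0 ≤ maxNontrivialEigenvalue P := by
    refine Real.sSup_nonneg ?_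
    rintro r ⟨μ, -, -, rfl⟩
    exact abs_nonneg μ
  have hl1 : maxNontrivialEigenvalue P ≤ 1 - 1 / (2 * T) := Real.sSup_le hub hnn
  have hgap : 1 / (2 * (T : ℝ)) ≤ gap P := by rw [gap]; linarith
  have hgap0 : 0 < gap P := lt_of_lt_of_le (by positivity) hgap
  refine ⟨?_, ?_, ?_⟩
  · rw [tRel]
    exact (one_le_inv₀ hgap0).2 (by rw [gap]; linarith)
  · rw [tRel]
    refine inv_le_of_inv_le₀ (by positivity) ?_
    rwa [← one_div]
  · refine C.hasPoincare (by rw [gap] at hgap0; linarith) fun μ hμ hμ1 => ?_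
    exact (le_abs_self μ).trans (le_csSup ⟨_, hub⟩ ⟨μ, hμ, hμ1, rfl⟩)

end IsLazyReversible

end Spectral

/-! ### Comparison of constants and assembly of the two-sided window. -/

lemma windowConst_pos (ε : ℝ) : 0 < windowConst ε := by
  refine lt_max_of_lt_right (lt_max_of_lt_right (by norm_num))

/-- For `ε ≥ 1/12` the value `24 · 64` suffices. For smaller `ε` the power `ε^(-5/2)` gains a factor
`1/ε`, and `35 ε < 35/12 < 3 ≤ log₂ (1/ε)`. -/
lemma div_sqrt_pow_le_windowConst {ε : ℝ} (hε₀ : 0 < ε) : 35 / √ε ^ 3 ≤ windowConst ε := by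
  have hr : 0 < √ε := Real.sqrt_pos.2 hε₀
  rcases le_or_gt (1 / 12) ε with h | h
  · have h1 : (0.2886 : ℝ) ≤ √ε := Real.le_sqrt_of_sq_le (by norm_num at h ⊢; linarith)
    have h2 : (0.2886 : ℝ) ^ 3 ≤ √ε ^ 3 := pow_le_pow_left₀ (by norm_num) h1 3
    have h3 : 35 / √ε ^ 3 ≤ 24 * 64 := by
      rw [div_le_iff₀ (by positivity)]
      norm_num at h2
      linarith
    refine h3.trans (le_max_of_le_left ?_)
    exact mul_le_mul_of_nonneg_left (le_max_right _ _) (by norm_num)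
  · refine le_max_of_le_right (le_max_of_le_left ?_)
    have h1 : ε ^ (5 / 2 : ℝ) = √ε ^ 3 * ε := by
      nth_rewrite 3 [← Real.sq_sqrt hε₀.le]
      rw [← pow_add, Real.sqrt_eq_rpow, ← Real.rpow_natCast, ← Real.rpow_mul hε₀.le]
      norm_num
    have h2 : 3 ≤ Real.logb 2 (1 / ε) := by
      rw [Real.le_logb_iff_rpow_le (by norm_num) (by positivity), le_div_iff₀ hε₀]
      norm_num
      linarith
    rw [h1, div_le_div_iff₀ (by positivity) (by positivity)]
    have h3 : 35 * ε ≤ Real.logb 2 (1 / ε) := by linarith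
    have h4 : 0 < √ε ^ 3 := by positivity
    nlinarith

section Window

variable {n : ℕ} {P : Matrix (Fin (n + 1)) (Fin (n + 1)) ℝ} {π : Fin (n + 1) → ℝ}

/-- Mixing to `ε` has to wait for the slower end, while each end alone delays mixing to `1 - ε`;
hence the maximum of the two window positions serves both bounds. Rounding up to an integer time
adds `1 ≤ W`, so `34` becomes `35`. -/
lemma IsLazyReversible.tMix_sub_tMix_le (C : IsLazyReversible P π) (hn : 1 ≤ n) {ε : ℝ}
    (hε₀ : 0 < ε) (hε : ε < 1 / 2) :
    (tMix P π ε : ℝ) - tMix P π (1 - ε) ≤ 35 / √ε ^ 3 * √(tRel P * tMix P π (1 / 4)) := by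
  obtain ⟨hR1, hRT, hP⟩ := C.tRel_bounds hn
  set T := tMix P π (1 / 4) with hTdef
  have hworst : worstDist P π T ≤ 1 / 4 := C.worstDist_tMix_le (by norm_num)
  obtain ⟨U, hU0, hU1, hU2⟩ := C.exists_window hε₀ hε hP hR1 hRT fun k hk =>
    (C.tvDist_ge (C.sum_pow_row T 0) hk).trans ((tvDist_le_worstDist P π T 0).trans hworst)
  obtain ⟨U', -, hU1', hU2'⟩ := C.reflect.exists_window hε₀ hε hP.reflect hR1 hRT fun k hk =>
    (C.reflect.tvDist_ge (C.reflect.sum_pow_row T 0) hk).trans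
      ((tvDist_reflect P π T).trans_le ((tvDist_le_worstDist P π T _).trans hworst))
  set W := √(tRel P * T) / √ε ^ 3 with hW
  have hupper : (tMix P π ε : ℝ) ≤ max U U' + 1 := by
    have hceil : max U U' ≤ ⌈max U U'⌉₊ := Nat.le_ceil _
    have h1 : tMix P π ε ≤ ⌈max U U'⌉₊ := by
      refine Nat.sInf_le ?_
      have := worstDist_le_of_ends C (hU1 _ ((le_max_left _ _).trans hceil))
        (hU1' _ ((le_max_right _ _).trans hceil))
      rwa [add_halves] at this
    have h2 : (⌈max U U'⌉₊ : ℝ) < max U U' + 1 := Nat.ceil_lt_add_one (le_max_of_le_left hU0)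
    have h3 : (tMix P π ε : ℝ) ≤ ⌈max U U'⌉₊ := by exact_mod_cast h1
    linarith
  have hlow : worstDist P π (tMix P π (1 - ε)) ≤ 1 - ε := C.worstDist_tMix_le (by linarith)
  have hlower : U - 34 * W < tMix P π (1 - ε) := by
    by_contra! h
    have := tvDist_le_worstDist P π (tMix P π (1 - ε)) 0
    linarith [hU2 _ h]
  have hlower' : U' - 34 * W < tMix P π (1 - ε) := by
    by_contra! h
    have h1 := hU2' _ h
    rw [tvDist_reflect] at h1
    have := tvDist_le_worstDist P π (tMix P π (1 - ε)) (Fin.last n)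
    linarith
  have hmax : max U U' < tMix P π (1 - ε) + 34 * W := max_lt (by linarith) (by linarith)
  have hW1 : 1 ≤ W := by
    have hr : 0 < √ε := Real.sqrt_pos.2 hε₀
    have hr1 : √ε ≤ 1 := Real.sqrt_le_one.2 (by linarith)
    have hT1 : (1 : ℝ) ≤ T := by exact_mod_cast C.one_le_tMix hn
    rw [hW, le_div_iff₀ (by positivity), one_mul]
    refine (pow_le_one₀ hr.le hr1).trans (Real.one_le_sqrt.2 ?_)
    nlinarith
  have e : 35 / √ε ^ 3 * √(tRel P * T) = 35 * W := by
    rw [hW]; ring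
  rw [e]
  linarith

end Window

lemma tMix_eq_zero_of_one_state {P : Matrix (Fin (0 + 1)) (Fin (0 + 1)) ℝ}
    {π : Fin (0 + 1) → ℝ} (hπ : IsStationaryDistribution P π) {ε : ℝ} (hε : 0 < ε) :
    tMix P π ε = 0 := by
  have h0 : π 0 = 1 := by simpa using hπ.1.2
  refine Nat.sInf_eq_zero.2 (Or.inl ?_)
  change worstDist P π 0 ≤ ε
  unfold worstDist
  refine ciSup_le fun x => ?_
  obtain rfl : x = 0 := Fin.ext (by omega)
  simp [tvDist, h0, hε.le]

end BirthDeath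

theorem theorem1 (ε : ℝ) (hε₀ : 0 < ε) (hε : ε < 1 / 2) :
    0 < BirthDeath.windowConst ε ∧
    ∀ (n : ℕ) (P : Matrix (Fin (n + 1)) (Fin (n + 1)) ℝ) (π : Fin (n + 1) → ℝ),
      BirthDeath.IsBirthDeathChain P → P.IsIrreducible → BirthDeath.IsLazy P →
      BirthDeath.IsStationaryDistribution P π →
      (BirthDeath.tMix P π ε : ℝ) - (BirthDeath.tMix P π (1 - ε) : ℝ) ≤
        BirthDeath.windowConst ε *
          √(BirthDeath.tRel P * (BirthDeath.tMix P π (1 / 4) : ℝ)) := by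
  refine ⟨BirthDeath.windowConst_pos ε, fun n P π hBD hirr hlazy hπ => ?_⟩
  -- A single state is mixed at time zero, so the bound `1 ≤ tMix P π (1 / 4)` fails there and the
  -- case is treated apart.
  rcases n with _ | n
  · rw [BirthDeath.tMix_eq_zero_of_one_state hπ hε₀]
    have h1 := mul_nonneg (BirthDeath.windowConst_pos ε).le
      (Real.sqrt_nonneg (BirthDeath.tRel P * (BirthDeath.tMix P π (1 / 4) : ℝ)))
    have h2 : (0 : ℝ) ≤ BirthDeath.tMix P π (1 - ε) := Nat.cast_nonneg _
    push_cast
    linarith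
  · have C := hBD.isLazyReversible hirr hlazy hπ
    exact (C.tMix_sub_tMix_le (by omega) hε₀ hε).trans
      (mul_le_mul_of_nonneg_right (BirthDeath.div_sqrt_pow_le_windowConst hε₀)
        (Real.sqrt_nonneg _))
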